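/- Let $\Bbbk$ be an algebraically closed field of characteristic $2$, let $m\ge 1$, put $n=2m+1$, and let $E$ be a $\Bbbk$-vector space of dimension $n$. Let $(q_0,q_1)$ be a regular pair of quadratic forms on $E$, i.e. the subscheme $V(q_0,q_1)$ of the projective space $|E|$ of lines in $E$ is smooth of codimension $2$; equivalently, at every $v\ne 0$ with $q_0(v)=q_1(v)=0$ the linear forms $b_0(v,\cdot)$ and $b_1(v,\cdot)$ are linearly independent, where $b_i(v,w)=q_i(v+w)-q_i(v)-q_i(w)$. For $u=(u_0,u_1)\in\Bbbk^2$ put $q_u=u_0q_0+u_1q_1$, with polar form $b_u$. Let $\mathrm{Aut}(q_0,q_1)$ be the group of all $g\in \mathrm{GL}(E)$ with $q_0(gv)=q_0(v)$ and $q_1(gv)=q_1(v)$ for all $v\in E$. Then there are exactly $n$ points $[x]\in\mathbb{P}^1(\Bbbk)$ for which the quadric $V(q_x)$ is singular, and each of these quadrics has exactly one singular point. Let $[x_1],\dots,[x_n]$ be these points, in any order, and let $z_i\in E$ be a non-zero vector representing the singular point of $V(q_{x_i})$ (so $q_{x_i}(z_i)=0$ and $b_{x_i}(z_i,\cdot)=0$).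 For $u\in\Bbbk^2$ not proportional to $x_i$ one has $q_u(z_i)\neq 0$, and the reflection $$\rho_i(v)=v+\frac{b_u(z_i,v)}{q_u(z_i)}\,z_i\qquad(v\in E)$$ does not depend on the choice of $u$ and lies in $\mathrm{Aut}(q_0,q_1)$. The group $\mathrm{Aut}(q_0,q_1)$ is an elementary abelian $2$-group of order $2^{2m}$. It is generated by $\rho_1,\dots,\rho_n$, as an elementary abelian $2$-group, subject only to the relation $\rho_1\cdots\rho_n=1$; that is, for integers $c_1,\dots,c_n$ one has $\rho_1^{c_1}\cdots\rho_n^{c_n}=1$ if and only if the $c_i$ are all even or all odd. -/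

import Mathlib

namespace QuadricPair

/-- The member `u₀ q₀ + u₁ q₁` of the pencil spanned by `q₀` and `q₁`. -/
def pencil {k E : Type*} [Field k] [AddCommGroup E] [Module k E]
    (q₀ q₁ : QuadraticForm k E) (u : k × k) : QuadraticForm k E :=
  u.1 • q₀ + u.2 • q₁

/-- `v` is a singular vector of `q`: it is non-zero, `q v = 0`, and `v` lies in the radical of the
polar form of `q`.  Then `[v]` is a singular point of the quadric `V(q)`. -/
def IsSingularVector {k E : Type*} [Field k] [AddCommGroup E] [Module k E]
    (q : QuadraticForm k E) (v : E) : Prop :=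
  v ≠ 0 ∧ q v = 0 ∧ ∀ w : E, QuadraticMap.polar q v w = 0

/-- The set of points `[u]` of the projective line parametrizing the pencil for which the quadric
`V(u₀ q₀ + u₁ q₁)` is singular (over an algebraically closed field). -/
def singularMembers {k E : Type*} [Field k] [AddCommGroup E] [Module k E]
    (q₀ q₁ : QuadraticForm k E) : Set (Projectivization k (k × k)) :=
  {p | ∃ (u : k × k) (hu : u ≠ 0), Projectivization.mk k u hu = p ∧
    ∃ v : E, IsSingularVector (pencil q₀ q₁ u) v}

/-- Over an algebraically closed field: the scheme `V(q₀, q₁)` in the projective space of lines of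
`E` is smooth of codimension `2`.  At every point `[v]` of it the differentials
`d q₀ = b₀(v, ·)` and `d q₁ = b₁(v, ·)` of the two equations are linearly independent, that is, the
Jacobian matrix has rank `2`. -/
def IsRegular {k E : Type*} [Field k] [AddCommGroup E] [Module k E]
    (q₀ q₁ : QuadraticForm k E) : Prop :=
  ∀ v : E, v ≠ 0 → q₀ v = 0 → q₁ v = 0 →
    LinearIndependent k ![q₀.polarBilin v, q₁.polarBilin v]

/-- The group of linear automorphisms of `E` that preserve both `q₀` and `q₁`. -/
def Aut {k E : Type*} [Field k] [AddCommGroup E] [Module k E]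
    (q₀ q₁ : QuadraticForm k E) : Subgroup (E ≃ₗ[k] E) where
  carrier := {g | (∀ v, q₀ (g v) = q₀ v) ∧ ∀ v, q₁ (g v) = q₁ v}
  one_mem' := ⟨fun _ => rfl, fun _ => rfl⟩
  mul_mem' := fun {g h} hg hh =>
    ⟨fun v => (hg.1 (h v)).trans (hh.1 v), fun v => (hg.2 (h v)).trans (hh.2 v)⟩
  inv_mem' := fun {g} hg =>
    ⟨fun v => by
      have h := hg.1 (g⁻¹ v)
      rw [← LinearEquiv.mul_apply, mul_inv_cancel] at h
      exact h.symm,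
    fun v => by
      have h := hg.2 (g⁻¹ v)
      rw [← LinearEquiv.mul_apply, mul_inv_cancel] at h
      exact h.symm⟩

end QuadricPair

/-! ### Alternating forms, degenerate members of a pencil, and chains of vectors -/

namespace QuadricPair

open Module

/-! In characteristic two the polar forms `b₀`, `b₁` are alternating, so in odd dimension every
member of the pencil has odd corank. Corank three or more would produce a common zero of `q₀` and
`q₁` inside a radical, against regularity; hence every corank is one (`IsRegular.finrank_ker`).
Kronecker's theory (`exists_kronecker_chain`) then gives independent `e 0, …, e m` with `b₀ (e 0) =
0` and `b₀ (e (i + 1)) = b₁ (e i)`. The vector `r(t) = ∑ tⁱ e i` spans the radical of `b₀ + t b₁`,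
and the span `W` of the chain is isotropic for both polar forms.

Put `Δ(t) = (q₀ + t q₁)(r(t))`. Since squares have zero derivative, `Δ'(t) = q₁(r(t))`, so
regularity says that `Δ` has only simple roots. If `q₁` has no singular vector, `Δ` has degree `2m +
1`, and its roots are the singular members. A change of coordinates reduces to this case.

An automorphism `g` maps each radical line to itself and preserves the value of the form on it. It
therefore fixes `r(t)` whenever `Δ(t) ≠ 0`, hence fixes `W` pointwise, and `g - 1` maps `E` into
`W`. Thus `g ↦ g - 1` turns composition into addition. In coordinates `g - 1` is a Hankel matrix
with `2m` free entries. By Vandermonde it is a unique combination of the displacements of the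
reflections at any `2m` roots of `Δ`. Invariance of `q₁` and `q₀` supplies the even and odd moments
of a system that forces each coefficient to be 0 or 1 (`IsKroneckerChain.exists_eq_id_add_sum`).
This gives generation and the order. Applied to the remaining reflection, it gives the one relation,
because any `2m` of the displacements are independent. -/

/-- The rank of an alternating bilinear form is even. -/
theorem even_finrank_add_finrank_ker {k : Type*} [Field k] (n : ℕ) :
    ∀ {V : Type*} [AddCommGroup V] [Module k V] [FiniteDimensional k V]
      (b : LinearMap.BilinForm k V), (∀ x, b x x = 0) → finrank k V = n →
      Even (finrank k V + finrank k (LinearMap.ker b)) := by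
  induction n using Nat.strong_induction_on with
  | _ n ih =>
  intro V _ _ _ b halt hn
  have hskew : ∀ x y, b x y = - b y x := fun x y => by
    have h := halt (x + y)
    simp only [map_add, LinearMap.add_apply, halt, zero_add, add_zero] at h
    exact eq_neg_of_add_eq_zero_right h
  by_cases hb : b = 0
  · subst hb
    rw [LinearMap.ker_zero, finrank_top]
    exact ⟨_, rfl⟩
  obtain ⟨v, w, hvw⟩ : ∃ v w, b v w ≠ 0 := by
    by_contra! h
    exact hb (LinearMap.ext fun v => LinearMap.ext fun w => h v w)
  have hwv : b w v ≠ 0 := by rw [hskew]; exact neg_ne_zero.mpr hvw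
  -- Split off the hyperbolic plane spanned by `v` and `w`: its orthogonal complement has
  -- codimension two and the same radical as `b`.
  let p : V →ₗ[k] k × k := (b v).prod (b w)
  have hp : Function.Surjective p := by
    rintro ⟨s, t⟩
    refine ⟨(s / b v w) • w + (t / b w v) • v, ?_⟩
    simp [p, halt, hvw, hwv]
  let U := LinearMap.ker p
  have hU : finrank k U + 2 = n := by
    have h := LinearMap.finrank_range_add_finrank_ker p
    rw [LinearMap.range_eq_top.mpr hp, finrank_top, finrank_prod, finrank_self] at h
    change finrank k (LinearMap.ker p) + 2 = n
    omega
  have hmem : ∀ x, x ∈ U ↔ b v x = 0 ∧ b w x = 0 := fun x => by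
    simp [U, p]
  have hker : (LinearMap.ker (b.restrict U)).map U.subtype = LinearMap.ker b := by
    ext x
    simp only [Submodule.mem_map, LinearMap.mem_ker, Submodule.subtype_apply]
    constructor
    · rintro ⟨⟨y, hy⟩, hy0, rfl⟩
      obtain ⟨h1, h2⟩ := (hmem y).1 hy
      ext z
      have hz : z - ((b v z / b v w) • w + (b w z / b w v) • v) ∈ U := by
        rw [hmem]
        constructor <;> simp [halt, hvw, hwv]
      have h3 : b y _ = 0 := LinearMap.congr_fun hy0 ⟨_, hz⟩
      have h4 : b y w = 0 := by rw [hskew, h2, neg_zero]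
      have h5 : b y v = 0 := by rw [hskew, h1, neg_zero]
      simpa [h4, h5] using h3
    · intro hx
      have h0 : ∀ y, b y x = 0 := fun y => by rw [hskew, hx]; simp
      refine ⟨⟨x, (hmem x).2 ⟨h0 v, h0 w⟩⟩, ?_, rfl⟩
      ext z
      change b x z = 0
      rw [hx, LinearMap.zero_apply]
  have h := ih (finrank k U) (by omega) (b.restrict U) (fun x => halt x) rfl
  rw [← hker, Submodule.finrank_map_subtype_eq]
  rw [hn, ← hU]
  rw [add_right_comm]
  exact h.add even_two

/-- A pencil of bilinear forms on a non-zero space over an algebraically closed field has a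
degenerate member. -/
theorem exists_pencil_degenerate {k E : Type*} [Field k] [IsAlgClosed k] [AddCommGroup E]
    [Module k E] [FiniteDimensional k E] (b₀ b₁ : LinearMap.BilinForm k E) (C : Submodule k E)
    (hC : C ≠ ⊥) :
    ∃ u : k × k, u ≠ 0 ∧ ∃ v ∈ C, v ≠ 0 ∧ ∀ w ∈ C, (u.1 • b₀ + u.2 • b₁) v w = 0 := by
  by_cases hinj : LinearMap.ker (b₁.restrict C) = ⊥
  · have : Nontrivial C := Submodule.nontrivial_iff_ne_bot.mpr hC
    let B : C ≃ₗ[k] Dual k C := LinearEquiv.ofInjectiveOfFinrankEq (b₁.restrict C)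
      (LinearMap.ker_eq_bot.mp hinj) Subspace.dual_finrank_eq.symm
    -- An eigenvector of `b₁⁻¹ b₀` with eigenvalue `μ` lies in the radical of `b₀ - μ b₁` on `C`.
    obtain ⟨μ, hμ⟩ := Module.End.exists_eigenvalue (B.symm.toLinearMap ∘ₗ b₀.restrict C)
    obtain ⟨v, hv⟩ := hμ.exists_hasEigenvector
    have h1 : b₀.restrict C v = μ • b₁.restrict C v := by
      have h2 := congrArg B hv.apply_eq_smul
      rw [map_smul] at h2
      simp only [LinearMap.comp_apply, LinearEquiv.coe_coe, LinearEquiv.apply_symm_apply] at h2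
      exact h2
    refine ⟨(1, -μ), by simp, v, v.2, by simpa using hv.2, fun w hw => ?_⟩
    have h3 : b₀ v w = μ * b₁ v w := LinearMap.congr_fun h1 ⟨w, hw⟩
    simp [h3]
  · obtain ⟨v, hv, hv0⟩ := Submodule.exists_mem_ne_zero_of_ne_bot hinj
    refine ⟨(0, 1), by simp, v, v.2, by simpa using hv0, fun w hw => ?_⟩
    simpa using LinearMap.congr_fun (LinearMap.mem_ker.1 hv) ⟨w, hw⟩

/-- For a symmetric form, a functional vanishing on the radical is represented by a vector. -/
theorem exists_apply_eq_of_ker {k E : Type*} [Field k] [AddCommGroup E]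
    [Module k E] [FiniteDimensional k E] (b : LinearMap.BilinForm k E)
    (hs : ∀ x y, b x y = b y x) (l : Dual k E) (hl : ∀ x ∈ LinearMap.ker b, l x = 0) :
    ∃ w, b w = l := by
  have h : LinearMap.range b = (LinearMap.ker b).dualAnnihilator := by
    apply Submodule.eq_of_le_of_finrank_eq
    · rintro _ ⟨w, rfl⟩
      rw [Submodule.mem_dualAnnihilator]
      intro x hx
      rw [hs, LinearMap.mem_ker.1 hx, LinearMap.zero_apply]
    · have h1 := LinearMap.finrank_range_add_finrank_ker b
      have h2 := Subspace.finrank_add_finrank_dualAnnihilator_eq (LinearMap.ker b)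
      exact Nat.add_right_cancel (h1.trans (by rw [add_comm, h2]))
  have h2 : l ∈ (LinearMap.ker b).dualAnnihilator := (Submodule.mem_dualAnnihilator _).2 hl
  rwa [← h] at h2

/-- Sequences `e` with `b₀ (e (i + 1)) = b₁ (e i)` are isotropic for `b₁`, as far as this
recursion holds. -/
theorem chain_isotropic {k E : Type*} [Field k] [AddCommGroup E] [Module k E]
    (b₀ b₁ : LinearMap.BilinForm k E) (hs₀ : ∀ x y, b₀ x y = b₀ y x) (hs₁ : ∀ x y, b₁ x y = b₁ y x)
    (ha₀ : ∀ x, b₀ x x = 0) (ha₁ : ∀ x, b₁ x x = 0) (e : ℕ → E) (N : ℕ)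
    (h : ∀ i < N, b₀ (e (i + 1)) = b₁ (e i)) (d : ℕ) :
    ∀ a, 2 * a + d ≤ N → b₁ (e a) (e (a + d)) = 0 := by
  induction d using Nat.strong_induction_on with
  | _ d ih =>
  intro a haN
  match d, ih, haN with
  | 0, _, _ => exact ha₁ _
  | 1, _, haN => rw [← h a (by omega)]; exact ha₀ _
  -- Applying the recursion at both ends shrinks the gap by two and keeps the index sum `2 * a + d`.
  -- The gap ends at 0 or 1, where `b₁` or `b₀` is alternating.
  | d + 2, ih, haN =>
    rw [← h a (by omega), hs₀, show a + (d + 2) = a + d + 1 + 1 by ring, h (a + d + 1) (by omega),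
      hs₁, show a + d + 1 = a + 1 + d by ring]
    exact ih d (by omega) (a + 1) (by omega)

/-- The equation `b₀ w = b₁ (e i)` is solvable exactly when `b₁ (e i)` vanishes on the line `ker b₀`
spanned by `e 0`. This is isotropy of the part of the chain already built, so the recursion never
stops. -/
theorem exists_chain {k E : Type*} [Field k] [AddCommGroup E] [Module k E]
    [FiniteDimensional k E]
    (b₀ b₁ : LinearMap.BilinForm k E) (hs₀ : ∀ x y, b₀ x y = b₀ y x) (hs₁ : ∀ x y, b₁ x y = b₁ y x)
    (ha₀ : ∀ x, b₀ x x = 0) (ha₁ : ∀ x, b₁ x x = 0) (h1 : finrank k (LinearMap.ker b₀) = 1) :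
    ∃ e : ℕ → E, e 0 ≠ 0 ∧ b₀ (e 0) = 0 ∧ ∀ i, b₀ (e (i + 1)) = b₁ (e i) := by
  obtain ⟨e₀, he₀, hspan⟩ := finrank_eq_one_iff'.1 h1
  -- The step is made total so that the sequence can be defined before solvability is known; the
  -- value 0 in the other case is never used.
  have hstep : ∀ v, ∃ w, b₁ v e₀ = 0 → b₀ w = b₁ v := fun v => by
    by_cases hv : b₁ v e₀ = 0
    · obtain ⟨w, hw⟩ := exists_apply_eq_of_ker b₀ hs₀ (b₁ v) (fun x hx => by
        obtain ⟨c, hc⟩ := hspan ⟨x, hx⟩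
        have : x = c • (e₀ : E) := by rw [← Submodule.coe_smul, hc]
        rw [this, map_smul, hv, smul_zero])
      exact ⟨w, fun _ => hw⟩
    · exact ⟨0, fun h => absurd h hv⟩
  choose s hs using hstep
  let e : ℕ → E := fun i => Nat.rec (e₀ : E) (fun _ v => s v) i
  have key : ∀ i, b₀ (e (i + 1)) = b₁ (e i) := fun i => by
    induction i using Nat.strong_induction_on with
    | _ i ih =>
    apply hs
    have h := chain_isotropic b₀ b₁ hs₀ hs₁ ha₀ ha₁ e i ih i 0 (by omega)
    rw [zero_add, hs₁] at h
    exact h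
  exact ⟨e, by simpa [e] using he₀, e₀.2, key⟩

end QuadricPair

/-! ### Kronecker's normal form -/

namespace QuadricPair

open Module

/-- The recursion is invariant under replacing `e` by combinations of its shifts, because `b₀ (e 0)
= 0` absorbs the boundary term. The first linear dependence among the `e i` is such a combination,
so it can be used to make the chain end in zero. -/
theorem exists_terminating_chain {k E : Type*} [Field k] [AddCommGroup E] [Module k E]
    [FiniteDimensional k E] (b₀ b₁ : LinearMap.BilinForm k E) (e : ℕ → E) (he0 : e 0 ≠ 0)
    (h0 : b₀ (e 0) = 0) (hstep : ∀ i, b₀ (e (i + 1)) = b₁ (e i)) :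
    ∃ (d : ℕ) (e' : ℕ → E), LinearIndependent k (fun i : Fin (d + 1) => e' i) ∧ b₀ (e' 0) = 0 ∧
      (∀ i, b₀ (e' (i + 1)) = b₁ (e' i)) ∧ ∀ i, d < i → e' i = 0 := by
  classical
  have hex : ∃ N, ¬ LinearIndependent k (fun i : Fin N => e i) := by
    refine ⟨finrank k E + 1, fun h => ?_⟩
    have := h.fintype_card_le_finrank
    simp at this
  obtain ⟨d, hd⟩ : ∃ d, Nat.find hex = d + 2 := by
    have h1 : Nat.find hex ≠ 0 := fun h => by
      have := Nat.find_spec hex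
      rw [h] at this
      exact this linearIndependent_empty_type
    have h2 : Nat.find hex ≠ 1 := fun h => by
      have := Nat.find_spec hex
      rw [h] at this
      exact this (linearIndependent_unique_iff.2 (by simpa using he0))
    exact ⟨Nat.find hex - 2, by omega⟩
  have hLI : LinearIndependent k (fun i : Fin (d + 1) => e i) :=
    not_not.1 (Nat.find_min hex (m := d + 1) (by omega))
  have hdep : e (d + 1) ∈ Submodule.span k (Set.range fun i : Fin (d + 1) => e i) := by
    by_contra hcon
    have := Nat.find_spec hex
    rw [hd] at this
    apply this
    rw [linearIndependent_finSucc']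
    exact ⟨hLI, hcon⟩
  obtain ⟨a, ha⟩ := (Submodule.mem_span_range_iff_exists_fun k).1 hdep
  -- The coefficients of the dependence in reverse order, so that `c (d + 1)` is `e (d + 1)` minus
  -- its expansion. The change from `e` to `c` is unitriangular and keeps independence.
  let A : ℕ → k := fun l => if h : l < d + 1 then a ⟨d - l, by omega⟩ else 0
  let c : ℕ → E := fun j => e j - ∑ l ∈ Finset.range j, A l • e (j - 1 - l)
  have hc0 : c 0 = e 0 := by simp [c]
  have hcstep : ∀ j, b₀ (c (j + 1)) = b₁ (c j) := fun j => by
    simp only [c, map_sub, map_sum, map_smul, hstep]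
    congr 1
    rw [Finset.sum_range_succ]
    simp only [Nat.add_sub_cancel, Nat.sub_self, h0, smul_zero, add_zero]
    refine Finset.sum_congr rfl fun l hl => ?_
    rw [← hstep, show j - 1 - l + 1 = j - l by have := Finset.mem_range.1 hl; omega]
  have hcd : c (d + 1) = 0 := by
    simp only [c, Nat.add_sub_cancel]
    rw [sub_eq_zero, ← ha, Finset.sum_range, ← Equiv.sum_comp Fin.revPerm]
    refine Finset.sum_congr rfl fun i _ => ?_
    have hi := i.2
    simp only [A, hi, dif_pos, Fin.revPerm_apply, Fin.val_rev]
    congr 2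
    · exact Fin.ext (by simp [Fin.val_rev])
    · omega
  have hspan : ∀ j, j < d + 1 → e j ∈ Submodule.span k (Set.range fun i : Fin (d + 1) => c i) := by
    intro j
    induction j using Nat.strong_induction_on with
    | _ j ih =>
    intro hj
    have : e j = c j + ∑ l ∈ Finset.range j, A l • e (j - 1 - l) := by simp [c]
    rw [this]
    refine Submodule.add_mem _ (Submodule.subset_span ⟨⟨j, hj⟩, rfl⟩)
      (Submodule.sum_mem _ fun l hl => Submodule.smul_mem _ _ ?_)
    have := Finset.mem_range.1 hl
    exact ih _ (by omega) (by omega)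
  have hcLI : LinearIndependent k (fun i : Fin (d + 1) => c i) := by
    rw [linearIndependent_iff_card_le_finrank_span] at hLI ⊢
    refine hLI.trans (Submodule.finrank_mono (Submodule.span_le.2 ?_))
    rintro _ ⟨i, rfl⟩
    exact hspan i i.2
  -- Cutting off after `d` respects the recursion, since `b₁ (c d) = b₀ (c (d + 1)) = 0`.
  refine ⟨d, fun j => if j ≤ d then c j else 0, ?_, by simpa [hc0] using h0, fun j => ?_,
    fun j hj => if_neg (by omega)⟩
  · convert hcLI using 2 with i
    exact if_pos (by omega)
  · beta_reduce
    rcases lt_trichotomy j d with h | h | h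
    · rw [if_pos (show j + 1 ≤ d from h), if_pos h.le, hcstep]
    · rw [if_neg (by omega), if_pos h.le, ← hcstep, h, hcd]
    · rw [if_neg (by omega), if_neg (by omega), map_zero, map_zero]

/-- Kronecker's normal form for a pencil of alternating forms of constant corank one. -/
theorem exists_kronecker_chain {k E : Type*} [Field k] [IsAlgClosed k] [AddCommGroup E]
    [Module k E] [FiniteDimensional k E]
    (b₀ b₁ : LinearMap.BilinForm k E) (hs₀ : ∀ x y, b₀ x y = b₀ y x) (hs₁ : ∀ x y, b₁ x y = b₁ y x)
    (ha₀ : ∀ x, b₀ x x = 0) (ha₁ : ∀ x, b₁ x x = 0) (m : ℕ) (hn : finrank k E = 2 * m + 1)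
    (hrad : ∀ u : k × k, u ≠ 0 → finrank k (LinearMap.ker (u.1 • b₀ + u.2 • b₁)) = 1) :
    ∃ e : ℕ → E, LinearIndependent k (fun i : Fin (m + 1) => e i) ∧ b₀ (e 0) = 0 ∧
      (∀ i, b₀ (e (i + 1)) = b₁ (e i)) ∧ (∀ i, m < i → e i = 0) ∧
      ∀ v, (∀ i < m, b₁ (e i) v = 0) →
        v ∈ Submodule.span k (Set.range fun i : Fin (m + 1) => e i) := by
  have h1 : finrank k (LinearMap.ker b₀) = 1 := by
    have h := hrad (1, 0) (by simp)
    rwa [one_smul, zero_smul, add_zero] at h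
  obtain ⟨e, he0, h0, hstep⟩ := exists_chain b₀ b₁ hs₀ hs₁ ha₀ ha₁ h1
  obtain ⟨d, e, hLI, h0, hstep, hend⟩ := exists_terminating_chain b₀ b₁ e he0 h0 hstep
  have hfirst : b₁ (e d) = 0 := by rw [← hstep, hend _ (Nat.lt_succ_self d), map_zero]
  have hiso : ∀ i j, b₁ (e i) (e j) = 0 := by
    have : ∀ i j, i ≤ j → b₁ (e i) (e j) = 0 := fun i j hij => by
      obtain ⟨l, rfl⟩ := Nat.exists_eq_add_of_le hij
      exact chain_isotropic b₀ b₁ hs₀ hs₁ ha₀ ha₁ e (2 * i + l) (fun i _ => hstep i) l i le_rfl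
    intro i j
    rcases le_total i j with h | h
    · exact this i j h
    · rw [hs₁]; exact this j i h
  let W := Submodule.span k (Set.range fun i : Fin (d + 1) => e i)
  have hW : finrank k W = d + 1 := by
    simpa using finrank_span_eq_card hLI
  let L := Submodule.span k (Set.range fun i : Fin d => b₁ (e i))
  have hLle : finrank k L ≤ d := by
    have h := finrank_range_le_card (R := k) (fun i : Fin d => b₁ (e i))
    simpa [Set.finrank] using h
  have heL : ∀ i, b₁ (e i) ∈ L := fun i => by
    rcases lt_trichotomy i d with h | h | h
    · exact Submodule.subset_span ⟨⟨i, h⟩, rfl⟩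
    · rw [h, hfirst]; exact L.zero_mem
    · rw [hend i h, map_zero]; exact L.zero_mem
  have hmap : ∀ u : k × k, W.map (u.1 • b₀ + u.2 • b₁) ≤ L := fun u => by
    rw [Submodule.map_span, Submodule.span_le]
    rintro _ ⟨_, ⟨i, rfl⟩, rfl⟩
    simp only [LinearMap.add_apply, LinearMap.smul_apply, SetLike.mem_coe]
    refine L.add_mem (L.smul_mem _ ?_) (L.smul_mem _ (heL _))
    rcases hi : (i : ℕ) with _ | j
    · rw [h0]; exact L.zero_mem
    · rw [hstep]; exact heL _
  -- `W` has dimension `d + 1`, its image lies in `L` of dimension at most `d`, and the kernel has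
  -- dimension at most one, so all these bounds are attained.
  have hdim : ∀ u : k × k, u ≠ 0 → W.map (u.1 • b₀ + u.2 • b₁) = L ∧
      LinearMap.ker (u.1 • b₀ + u.2 • b₁) ≤ W ∧ finrank k L = d := fun u hu => by
    set b := u.1 • b₀ + u.2 • b₁ with hb
    have hr := LinearMap.finrank_range_add_finrank_ker (b.domRestrict W)
    rw [LinearMap.range_domRestrict, hW] at hr
    have hk : finrank k (LinearMap.ker (b.domRestrict W)) =
        finrank k ((LinearMap.ker (b.domRestrict W)).map W.subtype) :=
      (Submodule.finrank_map_subtype_eq _ _).symm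
    have hkle : (LinearMap.ker (b.domRestrict W)).map W.subtype ≤ LinearMap.ker b := by
      rintro _ ⟨x, hx, rfl⟩
      exact hx
    have h3 := Submodule.finrank_mono hkle
    have h4 := Submodule.finrank_mono (hmap u)
    have h5 := hrad u hu
    rw [← hb] at h4 h5
    have h6 : (LinearMap.ker (b.domRestrict W)).map W.subtype = LinearMap.ker b :=
      Submodule.eq_of_le_of_finrank_eq hkle (by omega)
    have h7 : W.map b = L := Submodule.eq_of_le_of_finrank_eq (hmap u) (by omega)
    refine ⟨h7, ?_, by omega⟩
    rw [← h6]
    exact Submodule.map_subtype_le _ _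
  let W' := L.dualCoannihilator
  have hW'mem : ∀ v, v ∈ W' ↔ ∀ l ∈ L, l v = 0 := fun v => Submodule.mem_dualCoannihilator v
  have hWW' : W ≤ W' := by
    refine Submodule.span_le.2 ?_
    rintro _ ⟨j, rfl⟩
    refine (hW'mem _).2 fun l hl => ?_
    induction hl using Submodule.span_induction with
    | mem l hl => obtain ⟨i, rfl⟩ := hl; exact hiso _ _
    | zero => rfl
    | add l l' _ _ h h' => rw [LinearMap.add_apply, h, h', add_zero]
    | smul c l _ h => rw [LinearMap.smul_apply, h, smul_zero]
  -- `C` is a complement of `W` in `W'`. If it were non-zero, some member `b` would have `v ≠ 0` in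
  -- `C` with `b v` zero on `C`. As `b v` also kills `W`, it lies in `L = b(W)`, and then `v ∈ W +
  -- ker b = W`.
  obtain ⟨C₀, hC₀⟩ := Submodule.exists_isCompl W
  let C := C₀ ⊓ W'
  have hCbot : C = ⊥ := by
    by_contra hC
    obtain ⟨u, hu, v, hvC, hv0, hv⟩ := exists_pencil_degenerate b₀ b₁ C hC
    obtain ⟨h7, h8, -⟩ := hdim u hu
    set b := u.1 • b₀ + u.2 • b₁ with hb
    have hsb : ∀ x y, b x y = b y x := fun x y => by simp [hb, hs₀ x y, hs₁ x y]
    have hbv : b v ∈ L := by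
      rw [← Subspace.dualCoannihilator_dualAnnihilator_eq (W := L),
        Submodule.mem_dualAnnihilator]
      intro x hx
      have hx' : x ∈ W ⊔ C₀ := by rw [hC₀.sup_eq_top]; trivial
      obtain ⟨y, hy, z, hz, rfl⟩ := Submodule.mem_sup.1 hx'
      have hzC : z ∈ C := ⟨hz, by simpa using W'.sub_mem hx (hWW' hy)⟩
      rw [map_add, hv z hzC, hsb, add_zero]
      exact (hW'mem v).1 hvC.2 _ (by rw [← h7]; exact Submodule.mem_map_of_mem hy)
    rw [← h7] at hbv
    obtain ⟨w, hw, hbw⟩ := hbv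
    have hvw : v - w ∈ W := h8 (by rw [LinearMap.mem_ker, map_sub, hbw, sub_self])
    have hvW : v ∈ W := by simpa using W.add_mem hvw hw
    exact hv0 (by simpa using hC₀.disjoint.le_bot ⟨hvW, hvC.1⟩)
  have hW'W : W' = W := by
    refine le_antisymm (fun x hx => ?_) hWW'
    have hx' : x ∈ W ⊔ C₀ := by rw [hC₀.sup_eq_top]; trivial
    obtain ⟨y, hy, z, hz, rfl⟩ := Submodule.mem_sup.1 hx'
    have hzC : z ∈ C := ⟨hz, by simpa using W'.sub_mem hx (hWW' hy)⟩
    rw [hCbot, Submodule.mem_bot] at hzC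
    rw [hzC, add_zero]
    exact hy
  -- Now `W` is the annihilator of `L`, so `d + (d + 1) = 2 * m + 1`.
  have hdm : d = m := by
    have h9 := Subspace.finrank_add_finrank_dualCoannihilator_eq L
    have h10 := (hdim (1, 0) (by simp)).2.2
    change finrank k L + finrank k W' = _ at h9
    rw [hW'W, hW, h10, hn] at h9
    omega
  subst hdm
  refine ⟨e, hLI, h0, hstep, hend, fun v hv => ?_⟩
  change v ∈ W
  rw [← hW'W, hW'mem]
  intro l hl
  induction hl using Submodule.span_induction with
  | mem l hl => obtain ⟨i, rfl⟩ := hl; exact hv _ i.2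
  | zero => rfl
  | add l l' _ _ h h' => rw [LinearMap.add_apply, h, h', add_zero]
  | smul c l _ h => rw [LinearMap.smul_apply, h, smul_zero]

end QuadricPair

/-! ### Singular vectors and coranks in a regular pencil -/

namespace QuadricPair

open Module QuadraticMap

section Regular

variable {k E : Type*} [Field k] [AddCommGroup E] [Module k E] {q₀ q₁ : QuadraticForm k E}

theorem pencil_apply (u : k × k) (v : E) : pencil q₀ q₁ u v = u.1 * q₀ v + u.2 * q₁ v := rfl

theorem polar_pencil (u : k × k) (v w : E) :
    polar (pencil q₀ q₁ u) v w = u.1 * polar q₀ v w + u.2 * polar q₁ v w := by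
  simp only [polar, pencil_apply]
  ring

theorem polar_self_eq_zero [CharP k 2] (q : QuadraticForm k E) (v : E) : polar q v v = 0 := by
  rw [polar_self, two_smul, CharTwo.add_self_eq_zero]

theorem map_sum_smul_of_polar_eq_zero {ι : Type*} (q : QuadraticForm k E) (e : ι → E)
    (h : ∀ i j, polar q (e i) (e j) = 0) (s : Finset ι) (c : ι → k) :
    q (∑ i ∈ s, c i • e i) = ∑ i ∈ s, c i ^ 2 * q (e i) := by
  classical
  induction s using Finset.induction_on with
  | empty => simp
  | insert a s ha ih =>
    have h0 : polar q (c a • e a) (∑ i ∈ s, c i • e i) = 0 := by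
      change q.polarBilin _ _ = 0
      simp [h]
    rw [Finset.sum_insert ha, Finset.sum_insert ha, QuadraticMap.map_add q, h0, ih,
      QuadraticMap.map_smul, add_zero, smul_eq_mul]
    ring

/-- At a singular point of one member of a regular pair, no other member vanishes. -/
theorem IsRegular.not_both_zero (hreg : IsRegular q₀ q₁) {u : k × k} (hu : u ≠ 0) {v : E}
    (hv : v ≠ 0) (h : ∀ w, polar (pencil q₀ q₁ u) v w = 0) : ¬ (q₀ v = 0 ∧ q₁ v = 0) := by
  rintro ⟨h0, h1⟩
  have hli := LinearIndependent.pair_iff.1 (hreg v hv h0 h1) u.1 u.2 (by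
    ext w
    simpa [polar_pencil] using h w)
  exact hu (Prod.ext hli.1 hli.2)

theorem IsRegular.pencil_ne_zero (hreg : IsRegular q₀ q₁) {x u : k × k} (hx : x ≠ 0) {z : E}
    (hz : IsSingularVector (pencil q₀ q₁ x) z) (hu : u ∉ Submodule.span k {x}) :
    pencil q₀ q₁ u z ≠ 0 := by
  intro h0
  have h1 := hz.2.1
  rw [pencil_apply] at h0 h1
  -- Since `u` and `x` are independent, `q_u` and `q_x` span the pencil, and Cramer's rule would
  -- make both `q₀` and `q₁` vanish at `z`.
  have hdet : u.1 * x.2 - u.2 * x.1 ≠ 0 := fun hd => by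
    apply hu
    rw [Submodule.mem_span_singleton]
    by_cases hx1 : x.1 = 0
    · have hx2 : x.2 ≠ 0 := fun h => hx (Prod.ext hx1 h)
      refine ⟨u.2 / x.2, Prod.ext ?_ ?_⟩
      · rw [hx1, mul_zero, sub_zero] at hd
        simp [hx1, (mul_eq_zero.1 hd).resolve_right hx2]
      · simp [hx2]
    · refine ⟨u.1 / x.1, Prod.ext ?_ ?_⟩
      · simp [hx1]
      · change u.1 / x.1 * x.2 = u.2
        field_simp
        linear_combination hd
  refine hreg.not_both_zero hx hz.1 hz.2.2 ⟨?_, ?_⟩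
  · refine (mul_eq_zero.1 ?_).resolve_left hdet
    linear_combination x.2 * h0 - u.2 * h1
  · refine (mul_eq_zero.1 ?_).resolve_left hdet
    linear_combination u.1 * h1 - x.1 * h0

theorem exists_zero_of_linearIndependent [IsAlgClosed k] (q : QuadraticForm k E) {x y : E}
    (h : LinearIndependent k ![x, y]) :
    ∃ s t : k, s • x + t • y ≠ 0 ∧ q (s • x + t • y) = 0 := by
  by_cases hy : q y = 0
  · refine ⟨0, 1, ?_, by simpa using hy⟩
    simpa using h.ne_zero 1
  · obtain ⟨t, ht⟩ := IsAlgClosed.exists_root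
      (Polynomial.C (q y) * Polynomial.X ^ 2 + Polynomial.C (polar q x y) * Polynomial.X
        + Polynomial.C (q x)) (by rw [Polynomial.degree_quadratic hy]; decide)
    refine ⟨1, t, fun h0 => one_ne_zero (LinearIndependent.pair_iff.1 h _ _ h0).1, ?_⟩
    simp only [Polynomial.IsRoot.def, Polynomial.eval_add, Polynomial.eval_mul, Polynomial.eval_C,
      Polynomial.eval_pow, Polynomial.eval_X] at ht
    rw [one_smul, QuadraticMap.map_add q, QuadraticMap.map_smul, polar_smul_right, smul_eq_mul,
      smul_eq_mul]
    linear_combination ht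

/-- A quadratic form whose polar form vanishes on `R` vanishes on a subspace of codimension at most
one of `R`, if square roots exist. -/
theorem exists_submodule_zero [IsAlgClosed k] [CharP k 2] [FiniteDimensional k E]
    (q : QuadraticForm k E)
    (R : Submodule k E) (hR : ∀ v ∈ R, ∀ w ∈ R, polar q v w = 0) :
    ∃ Z ≤ R, (∀ v ∈ Z, q v = 0) ∧ finrank k R ≤ finrank k Z + 1 := by
  let Z : Submodule k E :=
    { carrier := {v | v ∈ R ∧ q v = 0}
      add_mem' := fun {a b} ha hb => ⟨R.add_mem ha.1 hb.1, by
        rw [QuadraticMap.map_add q, ha.2, hb.2, hR _ ha.1 _ hb.1]; simp⟩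
      zero_mem' := ⟨R.zero_mem, QuadraticMap.map_zero q⟩
      smul_mem' := fun c v hv => ⟨R.smul_mem c hv.1, by
        rw [QuadraticMap.map_smul, hv.2, smul_zero]⟩ }
  refine ⟨Z, fun v hv => hv.1, fun v hv => hv.2, ?_⟩
  by_cases hZ : R ≤ Z
  · exact (Submodule.finrank_mono hZ).trans (Nat.le_succ _)
  obtain ⟨w, hw, hwZ⟩ := Set.not_subset.1 hZ
  have hqw : q w ≠ 0 := fun h => hwZ ⟨hw, h⟩
  have hle : R ≤ Z ⊔ Submodule.span k {w} := fun v hv => by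
    -- On `R` the form is additive and scales by squares, so adding `√(q v / q w) • w` to `v`
    -- cancels the value of `q`.
    obtain ⟨c, hc⟩ := IsAlgClosed.exists_pow_nat_eq (q v / q w) (n := 2) (by norm_num)
    have hmem : v + c • w ∈ Z := by
      refine ⟨R.add_mem hv (R.smul_mem c hw), ?_⟩
      rw [QuadraticMap.map_add q, hR _ hv _ (R.smul_mem c hw), QuadraticMap.map_smul, ← pow_two, hc,
        smul_eq_mul, div_mul_cancel₀ _ hqw, CharTwo.add_self_eq_zero, add_zero]
    have h := Submodule.add_mem_sup hmem
      (Submodule.smul_mem _ (-c) (Submodule.mem_span_singleton_self w))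
    simpa using h
  calc finrank k R ≤ finrank k ↥(Z ⊔ Submodule.span k {w}) := Submodule.finrank_mono hle
    _ ≤ finrank k Z + finrank k ↥(Submodule.span k {w}) :=
      Submodule.finrank_add_le_finrank_add_finrank _ _
    _ ≤ finrank k Z + 1 := by
      have := finrank_span_le_card (R := k) ({w} : Set E)
      simp only [Set.toFinset_singleton, Finset.card_singleton] at this
      omega

/-- The members of a regular pencil on an odd-dimensional space have a polar form of corank one. -/
theorem IsRegular.finrank_ker [IsAlgClosed k] [CharP k 2] [FiniteDimensional k E]
    (hreg : IsRegular q₀ q₁) (hodd : Odd (finrank k E)) {u : k × k} (hu : u ≠ 0) :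
    finrank k (LinearMap.ker (u.1 • q₀.polarBilin + u.2 • q₁.polarBilin)) = 1 := by
  classical
  set b := u.1 • q₀.polarBilin + u.2 • q₁.polarBilin with hb
  have hbp : ∀ v w, b v w = polar (pencil q₀ q₁ u) v w := fun v w => by
    simp [hb, polar_pencil]
  have hpar := even_finrank_add_finrank_ker _ b
    (fun x => by rw [hbp]; exact polar_self_eq_zero _ _) rfl
  have hodd' : Odd (finrank k (LinearMap.ker b)) := by
    rw [Nat.even_add'] at hpar
    exact hpar.1 hodd
  by_contra hne
  have h3 : 3 ≤ finrank k (LinearMap.ker b) := by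
    obtain ⟨j, hj⟩ := hodd'
    omega
  have hker : ∀ v ∈ LinearMap.ker b, ∀ w, polar (pencil q₀ q₁ u) v w = 0 := fun v hv w => by
    rw [← hbp, LinearMap.mem_ker.1 hv, LinearMap.zero_apply]
  obtain ⟨Z, hZle, hZ, hdim⟩ := exists_submodule_zero (pencil q₀ q₁ u) (LinearMap.ker b)
    (fun v hv w _ => hker v hv w)
  obtain ⟨f, hf⟩ := exists_linearIndependent_of_le_finrank (R := k) (M := Z) (n := 2) (by omega)
  have hli : LinearIndependent k ![(f 0 : E), (f 1 : E)] := by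
    have h := hf.map' Z.subtype Z.ker_subtype
    have h' : Z.subtype ∘ f = ![(f 0 : E), (f 1 : E)] := by
      funext i
      fin_cases i <;> rfl
    rwa [h'] at h
  -- The second form is chosen to span the pencil together with `q_u`. A zero of it in a plane of
  -- `Z` is then a common zero of `q₀` and `q₁` in the radical.
  obtain ⟨s, t, h0, hq⟩ := exists_zero_of_linearIndependent
    (pencil q₀ q₁ (if u.1 = 0 then (1, 0) else (0, 1))) hli
  have hvZ := Z.add_mem (Z.smul_mem s (f 0).2) (Z.smul_mem t (f 1).2)
  set v := s • (f 0 : E) + t • (f 1 : E)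
  have hqu := hZ v hvZ
  rw [pencil_apply] at hqu hq
  refine hreg.not_both_zero hu h0 (hker v (hZle hvZ)) ?_
  by_cases h1 : u.1 = 0
  · have h2 : u.2 ≠ 0 := fun h => hu (Prod.ext h1 h)
    rw [if_pos h1] at hq
    have hq0 : q₀ v = 0 := by simpa using hq
    rw [hq0] at hqu
    exact ⟨hq0, by simpa [h2] using hqu⟩
  · rw [if_neg h1] at hq
    have hq1 : q₁ v = 0 := by simpa using hq
    rw [hq1] at hqu
    exact ⟨by simpa [h1] using hqu, hq1⟩

theorem IsRegular.mem_span_of_polar_eq_zero [IsAlgClosed k] [CharP k 2] [FiniteDimensional k E]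
    (hreg : IsRegular q₀ q₁) (hodd : Odd (finrank k E)) {u : k × k} (hu : u ≠ 0) {v w : E}
    (hv0 : v ≠ 0) (hv : ∀ x, polar (pencil q₀ q₁ u) v x = 0)
    (hw : ∀ x, polar (pencil q₀ q₁ u) w x = 0) : ∃ c : k, c • v = w := by
  have h := hreg.finrank_ker hodd hu
  have hmem : ∀ y, (∀ x, polar (pencil q₀ q₁ u) y x = 0) →
      y ∈ LinearMap.ker (u.1 • q₀.polarBilin + u.2 • q₁.polarBilin) := fun y hy => by
    rw [LinearMap.mem_ker]
    ext x
    simpa [polar_pencil] using hy x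
  obtain ⟨c, hc⟩ := (finrank_eq_one_iff_of_nonzero' (⟨v, hmem v hv⟩ : LinearMap.ker _)
    (by simpa using hv0)).1 h ⟨w, hmem w hw⟩
  exact ⟨c, by simpa using congrArg Subtype.val hc⟩

end Regular

end QuadricPair

/-! ### The half-discriminant and the number of singular members -/

namespace QuadricPair

open Module QuadraticMap Polynomial

/-- A Kronecker basis `e 0, …, e m` of the span of the radicals of the members of a pencil. -/
structure IsKroneckerChain {k E : Type*} [Field k] [AddCommGroup E] [Module k E]
    (q₀ q₁ : QuadraticForm k E) (m : ℕ) (e : ℕ → E) : Prop where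
  linearIndependent : LinearIndependent k (fun i : Fin (m + 1) => e i)
  polar_zero : ∀ v, polar q₀ (e 0) v = 0
  polar_succ : ∀ i v, polar q₀ (e (i + 1)) v = polar q₁ (e i) v
  eq_zero : ∀ i, m < i → e i = 0
  mem_span : ∀ v, (∀ i < m, polar q₁ (e i) v = 0) →
    v ∈ Submodule.span k (Set.range fun i : Fin (m + 1) => e i)

/-- The spanning vector `∑ tⁱ e i` of the radical of `q₀ + t q₁`. -/
def radicalVector {k E : Type*} [Field k] [AddCommGroup E] [Module k E] (m : ℕ) (e : ℕ → E)
    (t : k) : E :=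
  ∑ i : Fin (m + 1), t ^ (i : ℕ) • e i

/-- The half-discriminant of the pencil `q₀ + t q₁`. -/
noncomputable def halfDiscriminant {k E : Type*} [Field k] [AddCommGroup E] [Module k E]
    (q₀ q₁ : QuadraticForm k E) (m : ℕ) (e : ℕ → E) : k[X] :=
  ∑ i : Fin (m + 1), (C (q₀ (e i)) * X ^ (2 * (i : ℕ)) + C (q₁ (e i)) * X ^ (2 * (i : ℕ) + 1))

theorem IsRegular.exists_isKroneckerChain {k E : Type*} [Field k] [IsAlgClosed k] [CharP k 2]
    [AddCommGroup E] [Module k E] [FiniteDimensional k E] {q₀ q₁ : QuadraticForm k E}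
    (hreg : IsRegular q₀ q₁) {m : ℕ} (hn : finrank k E = 2 * m + 1) :
    ∃ e, IsKroneckerChain q₀ q₁ m e := by
  obtain ⟨e, h1, h2, h3, h4, h5⟩ := exists_kronecker_chain q₀.polarBilin q₁.polarBilin
    (fun x y => polar_comm q₀ x y) (fun x y => polar_comm q₁ x y)
    (polar_self_eq_zero q₀) (polar_self_eq_zero q₁) m hn
    (fun u hu => hreg.finrank_ker ⟨m, hn⟩ hu)
  exact ⟨e, h1, fun v => LinearMap.congr_fun h2 v, fun i v => LinearMap.congr_fun (h3 i) v, h4, h5⟩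

namespace IsKroneckerChain

variable {k E : Type*} [Field k] [AddCommGroup E] [Module k E] {q₀ q₁ : QuadraticForm k E}
  {m : ℕ} {e : ℕ → E}

theorem polar_last (he : IsKroneckerChain q₀ q₁ m e) (v : E) : polar q₁ (e m) v = 0 := by
  rw [← he.polar_succ, he.eq_zero _ (Nat.lt_succ_self m), polar_zero_left]

theorem polar_one_eq_zero [CharP k 2] (he : IsKroneckerChain q₀ q₁ m e) (i j : ℕ) :
    polar q₁ (e i) (e j) = 0 := by
  have h : ∀ i j, i ≤ j → polar q₁ (e i) (e j) = 0 := fun i j hij => by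
    obtain ⟨l, rfl⟩ := Nat.exists_eq_add_of_le hij
    exact chain_isotropic q₀.polarBilin q₁.polarBilin
      (fun x y => polar_comm q₀ x y) (fun x y => polar_comm q₁ x y)
      (polar_self_eq_zero q₀) (polar_self_eq_zero q₁) e (2 * i + l)
      (fun i _ => LinearMap.ext fun v => he.polar_succ i v) l i le_rfl
  rcases le_total i j with hij | hij
  · exact h i j hij
  · rw [polar_comm]; exact h j i hij

theorem polar_zero_eq_zero [CharP k 2] (he : IsKroneckerChain q₀ q₁ m e) (i j : ℕ) :
    polar q₀ (e i) (e j) = 0 := by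
  rcases i with _ | i
  · exact he.polar_zero _
  · rw [he.polar_succ]; exact he.polar_one_eq_zero i j

theorem polar_radicalVector_left (q : QuadraticForm k E) (t : k) (v : E) :
    polar q (radicalVector m e t) v = ∑ i : Fin (m + 1), t ^ (i : ℕ) * polar q (e i) v := by
  change q.polarBilin _ _ = _
  simp [radicalVector]

theorem polar_one_radicalVector (he : IsKroneckerChain q₀ q₁ m e) (t : k) (v : E) :
    polar q₁ (radicalVector m e t) v = ∑ i : Fin m, t ^ (i : ℕ) * polar q₁ (e i) v := by
  rw [polar_radicalVector_left, Fin.sum_univ_castSucc]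
  simp [he.polar_last]

theorem polar_zero_radicalVector (he : IsKroneckerChain q₀ q₁ m e) (t : k) (v : E) :
    polar q₀ (radicalVector m e t) v = t * polar q₁ (radicalVector m e t) v := by
  rw [he.polar_one_radicalVector, polar_radicalVector_left, Fin.sum_univ_succ, Finset.mul_sum]
  simp only [Fin.val_zero, he.polar_zero, mul_zero, zero_add, Fin.val_succ, he.polar_succ]
  exact Finset.sum_congr rfl fun i _ => by ring

theorem polar_pencil_radicalVector [CharP k 2] (he : IsKroneckerChain q₀ q₁ m e) (t : k) (v : E) :
    polar (pencil q₀ q₁ (1, t)) (radicalVector m e t) v = 0 := by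
  rw [polar_pencil, he.polar_zero_radicalVector, one_mul, CharTwo.add_self_eq_zero]

theorem radicalVector_ne_zero (he : IsKroneckerChain q₀ q₁ m e) (t : k) :
    radicalVector m e t ≠ 0 := fun h => by
  have h0 := Fintype.linearIndependent_iff.1 he.linearIndependent _ h 0
  simp at h0

theorem map_zero_radicalVector [CharP k 2] (he : IsKroneckerChain q₀ q₁ m e) (t : k) :
    q₀ (radicalVector m e t) = ∑ i : Fin (m + 1), (t ^ (i : ℕ)) ^ 2 * q₀ (e i) :=
  map_sum_smul_of_polar_eq_zero q₀ (fun i : Fin (m + 1) => e i)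
    (fun i j => he.polar_zero_eq_zero i j) _ _

theorem map_one_radicalVector [CharP k 2] (he : IsKroneckerChain q₀ q₁ m e) (t : k) :
    q₁ (radicalVector m e t) = ∑ i : Fin (m + 1), (t ^ (i : ℕ)) ^ 2 * q₁ (e i) :=
  map_sum_smul_of_polar_eq_zero q₁ (fun i : Fin (m + 1) => e i)
    (fun i j => he.polar_one_eq_zero i j) _ _

theorem eval_halfDiscriminant [CharP k 2] (he : IsKroneckerChain q₀ q₁ m e) (t : k) :
    (halfDiscriminant q₀ q₁ m e).eval t = pencil q₀ q₁ (1, t) (radicalVector m e t) := by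
  rw [pencil_apply, he.map_zero_radicalVector, he.map_one_radicalVector, one_mul, Finset.mul_sum,
    ← Finset.sum_add_distrib, halfDiscriminant, eval_finsetSum]
  refine Finset.sum_congr rfl fun i _ => ?_
  simp only [eval_add, eval_mul, eval_C, eval_pow, eval_X]
  ring

/-- Even powers of `X` have zero derivative in characteristic two, so only the part from `q₁`
survives, with each exponent lowered by one. -/
theorem eval_derivative_halfDiscriminant [CharP k 2] (he : IsKroneckerChain q₀ q₁ m e) (t : k) :
    (derivative (halfDiscriminant q₀ q₁ m e)).eval t = q₁ (radicalVector m e t) := by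
  have h2 : (2 : k) = 0 := CharTwo.two_eq_zero
  rw [he.map_one_radicalVector, halfDiscriminant, derivative_sum, eval_finsetSum]
  refine Finset.sum_congr rfl fun i _ => ?_
  simp only [derivative_add, derivative_mul, derivative_C, zero_mul, zero_add, derivative_X_pow,
    eval_add, eval_mul, eval_C, eval_pow, eval_X, Nat.cast_add, Nat.cast_mul, Nat.cast_ofNat,
    Nat.cast_one, h2, Nat.add_sub_cancel]
  ring

/-- At a double root both forms would vanish at the radical vector, which regularity forbids. -/
theorem derivative_ne_zero_of_isRoot [CharP k 2] (he : IsKroneckerChain q₀ q₁ m e)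
    (hreg : IsRegular q₀ q₁) {t : k} (ht : (halfDiscriminant q₀ q₁ m e).eval t = 0) :
    (derivative (halfDiscriminant q₀ q₁ m e)).eval t ≠ 0 := fun h => by
  rw [he.eval_derivative_halfDiscriminant] at h
  rw [he.eval_halfDiscriminant, pencil_apply, h] at ht
  exact hreg.not_both_zero (u := (1, t)) (by simp) (he.radicalVector_ne_zero t)
    (he.polar_pencil_radicalVector t) ⟨by simpa using ht, h⟩

theorem halfDiscriminant_ne_zero [CharP k 2] (he : IsKroneckerChain q₀ q₁ m e)
    (hreg : IsRegular q₀ q₁) : halfDiscriminant q₀ q₁ m e ≠ 0 := fun h => by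
  have h0 := he.derivative_ne_zero_of_isRoot hreg (t := 0) (by rw [h, eval_zero])
  rw [h] at h0
  simp at h0

/-- The top coefficient is `q₁ (e m)`, and `e m` lies in the radical of the polar form of `q₁`; it
could vanish only if `e m` were singular for `q₁`. -/
theorem natDegree_halfDiscriminant (he : IsKroneckerChain q₀ q₁ m e)
    (hsing : ∀ v, ¬ IsSingularVector q₁ v) :
    (halfDiscriminant q₀ q₁ m e).natDegree = 2 * m + 1 := by
  have hm : q₁ (e m) ≠ 0 := fun h => hsing (e m)
    ⟨he.linearIndependent.ne_zero (Fin.last m), h, he.polar_last⟩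
  apply le_antisymm
  · refine natDegree_sum_le_of_forall_le _ _ fun i _ => ?_
    have hi := i.2
    refine (natDegree_add_le _ _).trans (max_le ?_ ?_)
    · exact (natDegree_C_mul_X_pow_le _ _).trans (by omega)
    · exact (natDegree_C_mul_X_pow_le _ _).trans (by omega)
  · apply le_natDegree_of_ne_zero
    rw [halfDiscriminant, finsetSum_coeff, Finset.sum_eq_single (Fin.last m)]
    · simpa [coeff_C_mul, coeff_X_pow] using hm
    · intro i _ hi
      have h1 : (i : ℕ) ≠ m := fun h => hi (Fin.ext h)
      simp only [coeff_add, coeff_C_mul, coeff_X_pow]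
      rw [if_neg (by omega), if_neg (by omega)]
      simp
    · simp

variable [IsAlgClosed k] [CharP k 2] [FiniteDimensional k E]

theorem exists_smul_radicalVector (he : IsKroneckerChain q₀ q₁ m e) (hreg : IsRegular q₀ q₁)
    (hodd : Odd (finrank k E)) {t : k} {v : E}
    (hv : ∀ w, polar (pencil q₀ q₁ (1, t)) v w = 0) : ∃ c : k, c • radicalVector m e t = v :=
  hreg.mem_span_of_polar_eq_zero hodd (u := (1, t)) (by simp) (he.radicalVector_ne_zero t)
    (he.polar_pencil_radicalVector t) hv

theorem exists_isSingularVector_iff (he : IsKroneckerChain q₀ q₁ m e) (hreg : IsRegular q₀ q₁)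
    (hodd : Odd (finrank k E)) (t : k) :
    (∃ v, IsSingularVector (pencil q₀ q₁ (1, t)) v) ↔
      (halfDiscriminant q₀ q₁ m e).eval t = 0 := by
  rw [he.eval_halfDiscriminant]
  constructor
  · rintro ⟨v, hv0, hqv, hv⟩
    obtain ⟨c, rfl⟩ := he.exists_smul_radicalVector hreg hodd hv
    have hc : c ≠ 0 := fun h => hv0 (by rw [h, zero_smul])
    rw [QuadraticMap.map_smul, smul_eq_mul] at hqv
    exact (mul_eq_zero.1 hqv).resolve_left (mul_ne_zero hc hc)
  · exact fun h => ⟨_, he.radicalVector_ne_zero t, h, he.polar_pencil_radicalVector t⟩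

end IsKroneckerChain

variable {k E : Type*} [Field k] [IsAlgClosed k] [CharP k 2] [AddCommGroup E] [Module k E]
  [FiniteDimensional k E] {q₀ q₁ : QuadraticForm k E}

theorem IsRegular.exists_not_isSingularVector (hreg : IsRegular q₀ q₁)
    (hodd : Odd (finrank k E)) :
    ∃ t : k, ∀ v, ¬ IsSingularVector (pencil q₀ q₁ (1, t)) v := by
  obtain ⟨m, hm⟩ := id hodd
  obtain ⟨e, he⟩ := hreg.exists_isKroneckerChain hm
  by_contra! h
  apply he.halfDiscriminant_ne_zero hreg
  refine Polynomial.funext fun t => ?_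
  rw [eval_zero, ← he.exists_isSingularVector_iff hreg hodd]
  exact h t

/-- The hypothesis on `q₁` keeps singular members away from infinity, so the simple roots of the
half-discriminant account for all of them. -/
theorem IsRegular.exists_finset_card (hreg : IsRegular q₀ q₁) {m : ℕ}
    (hn : finrank k E = 2 * m + 1) (hsing : ∀ v, ¬ IsSingularVector q₁ v) :
    ∃ S : Finset k, S.card = 2 * m + 1 ∧
      ∀ t, t ∈ S ↔ ∃ v, IsSingularVector (pencil q₀ q₁ (1, t)) v := by
  classical
  obtain ⟨e, he⟩ := hreg.exists_isKroneckerChain hn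
  have h0 := he.halfDiscriminant_ne_zero hreg
  refine ⟨(halfDiscriminant q₀ q₁ m e).roots.toFinset, ?_, fun t => ?_⟩
  · have hnodup : (halfDiscriminant q₀ q₁ m e).roots.Nodup := by
      rw [Multiset.nodup_iff_count_le_one]
      intro t
      rw [count_roots]
      by_contra! hlt
      obtain ⟨h1, h2⟩ := (one_lt_rootMultiplicity_iff_isRoot h0).1 hlt
      exact he.derivative_ne_zero_of_isRoot hreg h1 h2
    rw [Multiset.toFinset_card_of_nodup hnodup,
      ← he.natDegree_halfDiscriminant hsing]
    exact (splits_iff_card_roots.1 (IsAlgClosed.splits _))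
  · rw [he.exists_isSingularVector_iff hreg ⟨m, hn⟩, Multiset.mem_toFinset, mem_roots h0]
    rfl

end QuadricPair

/-! ### Displacements of reflections, and the action of automorphisms on the chain -/

namespace QuadricPair

open Module QuadraticMap Polynomial

/-- The endomorphism `v ↦ (b(z, v) / q(z)) z`: the difference of the reflection in `z` and the
identity. -/
noncomputable def reflectionPart {k E : Type*} [Field k] [AddCommGroup E] [Module k E]
    (q : QuadraticForm k E) (z : E) : E →ₗ[k] E :=
  (q z)⁻¹ • (q.polarBilin z).smulRight z

theorem reflectionPart_apply {k E : Type*} [Field k] [AddCommGroup E] [Module k E]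
    (q : QuadraticForm k E) (z v : E) :
    reflectionPart q z v = (polar q z v / q z) • z := by
  simp only [reflectionPart, LinearMap.smul_apply, LinearMap.smulRight_apply,
    polarBilin_apply_apply, smul_smul]
  congr 1
  ring

theorem reflectionPart_smul {k E : Type*} [Field k] [AddCommGroup E] [Module k E]
    (q : QuadraticForm k E) {a : k} (ha : a ≠ 0) (z : E) :
    reflectionPart q (a • z) = reflectionPart q z := by
  ext v
  simp only [reflectionPart_apply, polar_smul_left, QuadraticMap.map_smul, smul_smul, smul_eq_mul]
  congr 1
  by_cases hq : q z = 0
  · simp [hq]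
  · field_simp

theorem Aut.polar_apply {k E : Type*} [Field k] [AddCommGroup E] [Module k E]
    {q₀ q₁ : QuadraticForm k E} {g : E ≃ₗ[k] E} (hg : g ∈ Aut q₀ q₁) (v w : E) :
    polar q₀ (g v) (g w) = polar q₀ v w ∧ polar q₁ (g v) (g w) = polar q₁ v w := by
  simp only [polar, ← map_add, hg.1, hg.2, and_self]

theorem exists_sum_mul_pow_eq {k : Type*} [Field k] {n : ℕ} {t : Fin n → k}
    (ht : Function.Injective t) (H : ℕ → k) :
    ∃ c : Fin n → k, ∀ j < n, ∑ i, c i * t i ^ j = H j := by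
  have hdet : IsUnit (Matrix.vandermonde t) :=
    (Matrix.isUnit_iff_isUnit_det _).2 (Matrix.det_vandermonde_ne_zero_iff.2 ht).isUnit
  obtain ⟨c, hc⟩ := Matrix.vecMul_surjective_iff_isUnit.2 hdet (fun j => H j)
  refine ⟨c, fun j hj => ?_⟩
  have h := congrFun hc ⟨j, hj⟩
  simpa [Matrix.vecMul, dotProduct, Matrix.vandermonde_apply] using h

theorem eq_zero_of_sum_mul_pow {k : Type*} [Field k] {n : ℕ} {t : Fin n → k}
    (ht : Function.Injective t) (c : Fin n → k) (h : ∀ j < n, ∑ i, c i * t i ^ j = 0) : c = 0 :=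
  Matrix.eq_zero_of_forall_pow_sum_mul_pow_eq_zero ht fun j => h j j.2

namespace IsKroneckerChain

variable {k E : Type*} [Field k] [AddCommGroup E] [Module k E] {q₀ q₁ : QuadraticForm k E}
  {m : ℕ} {e : ℕ → E}

/-- The functionals `b₁ (e i)`, `i < m`, have common kernel inside the span of the chain, of
dimension `m + 1`; by rank-nullity they map `E` onto `k ^ m`. -/
theorem exists_dual [FiniteDimensional k E] (he : IsKroneckerChain q₀ q₁ m e)
    (hn : finrank k E = 2 * m + 1) :
    ∃ f : Fin m → E, ∀ i j : Fin m, polar q₁ (e i) (f j) = if i = j then 1 else 0 := by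
  let p : E →ₗ[k] (Fin m → k) := LinearMap.pi fun i => q₁.polarBilin (e i)
  have hker : finrank k (LinearMap.ker p) ≤ m + 1 := by
    have hle : LinearMap.ker p ≤ Submodule.span k (Set.range fun i : Fin (m + 1) => e i) :=
      fun v hv => he.mem_span v fun i hi => congrFun (LinearMap.mem_ker.1 hv) ⟨i, hi⟩
    refine (Submodule.finrank_mono hle).trans ?_
    have h := finrank_span_eq_card he.linearIndependent
    simp only [Fintype.card_fin] at h
    exact h.le
  have hsurj : LinearMap.range p = ⊤ := by
    apply Submodule.eq_top_of_finrank_eq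
    have h1 := LinearMap.finrank_range_add_finrank_ker p
    have h2 := Submodule.finrank_le (LinearMap.range p)
    rw [finrank_fin_fun] at h2 ⊢
    omega
  choose f hf using LinearMap.range_eq_top.1 hsurj
  refine ⟨fun j => f (fun i => if i = j then 1 else 0), fun i j => ?_⟩
  exact congrFun (hf fun i => if i = j then 1 else 0) i

theorem ext_of_dual (he : IsKroneckerChain q₀ q₁ m e) {f : Fin m → E}
    (hf : ∀ i j : Fin m, polar q₁ (e i) (f j) = if i = j then 1 else 0) {φ ψ : E →ₗ[k] E}
    (h1 : ∀ i : Fin (m + 1), φ (e i) = ψ (e i)) (h2 : ∀ j, φ (f j) = ψ (f j)) : φ = ψ := by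
  ext v
  have hv : v - ∑ j : Fin m, polar q₁ (e j) v • f j ∈
      Submodule.span k (Set.range fun i : Fin (m + 1) => e i) := by
    refine he.mem_span _ fun i hi => ?_
    change q₁.polarBilin (e i) _ = 0
    rw [map_sub, map_sum, sub_eq_zero, Finset.sum_eq_single ⟨i, hi⟩]
    · simp [hf ⟨i, hi⟩ ⟨i, hi⟩]
    · intro j _ hj
      simp [hf ⟨i, hi⟩ j, Ne.symm hj]
    · simp
  have h3 := LinearMap.eqOn_span (f := φ) (g := ψ)
    (s := Set.range fun i : Fin (m + 1) => e i) (by rintro _ ⟨i, rfl⟩; exact h1 i) hv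
  simp only [map_sub, map_sum, map_smul, h2] at h3
  exact sub_left_injective h3

theorem polar_one_radicalVector_dual (he : IsKroneckerChain q₀ q₁ m e) {f : Fin m → E}
    (hf : ∀ i j : Fin m, polar q₁ (e i) (f j) = if i = j then 1 else 0) (t : k) (j : Fin m) :
    polar q₁ (radicalVector m e t) (f j) = t ^ (j : ℕ) := by
  rw [he.polar_one_radicalVector]
  simp [hf]

theorem reflectionPart_chain [CharP k 2] (he : IsKroneckerChain q₀ q₁ m e) (t : k) (i : ℕ) :
    reflectionPart q₁ (radicalVector m e t) (e i) = 0 := by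
  rw [reflectionPart_apply, he.polar_one_radicalVector]
  simp [he.polar_one_eq_zero]

theorem reflectionPart_dual (he : IsKroneckerChain q₀ q₁ m e) {f : Fin m → E}
    (hf : ∀ i j : Fin m, polar q₁ (e i) (f j) = if i = j then 1 else 0) (t : k) (j : Fin m) :
    reflectionPart q₁ (radicalVector m e t) (f j) =
      (t ^ (j : ℕ) / q₁ (radicalVector m e t)) • radicalVector m e t := by
  rw [reflectionPart_apply, he.polar_one_radicalVector_dual hf]

/-- Linear combinations of the endomorphisms attached to radical vectors, in coordinates. -/
theorem sum_smul_reflectionPart_dual (he : IsKroneckerChain q₀ q₁ m e) {f : Fin m → E}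
    (hf : ∀ i j : Fin m, polar q₁ (e i) (f j) = if i = j then 1 else 0) {ι : Type*} (s : Finset ι)
    (t c : ι → k) (j : Fin m) :
    ∑ l ∈ s, c l • reflectionPart q₁ (radicalVector m e (t l)) (f j) =
      ∑ i : Fin (m + 1), (∑ l ∈ s, c l / q₁ (radicalVector m e (t l)) *
        t l ^ ((i : ℕ) + j)) • e i := by
  simp only [he.reflectionPart_dual hf, Finset.sum_smul]
  rw [Finset.sum_comm]
  refine Finset.sum_congr rfl fun l _ => ?_
  rw [smul_smul]
  generalize q₁ (radicalVector m e (t l)) = d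
  rw [radicalVector, Finset.smul_sum]
  refine Finset.sum_congr rfl fun i _ => ?_
  rw [smul_smul]
  congr 1
  rw [pow_add]
  ring

/-- On the dual vectors a combination is a Hankel matrix whose entries are the moments `∑ c' l * t l
^ (i + j)`, with `c' l = c l / q₁ (r(t l))`. The sums `i + j` run through all exponents below `2 *
m`, so the square Vandermonde matrix at the `2 * m` nodes forces every coefficient to vanish. -/
theorem linearIndependent_reflectionPart [CharP k 2] [FiniteDimensional k E]
    (he : IsKroneckerChain q₀ q₁ m e) (hn : finrank k E = 2 * m + 1) {t : Fin (2 * m) → k}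
    (ht : Function.Injective t) (hq : ∀ l, q₁ (radicalVector m e (t l)) ≠ 0) :
    LinearIndependent k (fun l => reflectionPart q₁ (radicalVector m e (t l))) := by
  obtain ⟨f, hf⟩ := he.exists_dual hn
  rw [Fintype.linearIndependent_iff]
  intro c hc
  have h0 : (fun l => c l / q₁ (radicalVector m e (t l))) = 0 := by
    refine eq_zero_of_sum_mul_pow ht _ fun n hn2 => ?_
    obtain ⟨i, j, hij⟩ : ∃ (i : Fin (m + 1)) (j : Fin m), (i : ℕ) + j = n := by
      rcases Nat.lt_or_ge n m with h | h
      · exact ⟨⟨0, by omega⟩, ⟨n, h⟩, by simp⟩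
      · exact ⟨⟨m, by omega⟩, ⟨n - m, by omega⟩, by simp; omega⟩
    have h1 := LinearMap.congr_fun hc (f j)
    simp only [LinearMap.sum_apply, LinearMap.smul_apply, LinearMap.zero_apply] at h1
    rw [he.sum_smul_reflectionPart_dual hf] at h1
    rw [← hij]
    exact Fintype.linearIndependent_iff.1 he.linearIndependent _ h1 i
  intro l
  exact (div_eq_zero_iff.1 (congrFun h0 l)).resolve_right (hq l)

variable [IsAlgClosed k] [CharP k 2] [FiniteDimensional k E]

/-- An automorphism preserves the radical line of each member. The non-zero value of the form there
forces the scalar to have square 1, hence to be 1 in characteristic two. -/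
theorem apply_radicalVector (he : IsKroneckerChain q₀ q₁ m e)
    (hreg : IsRegular q₀ q₁) (hodd : Odd (finrank k E)) {g : E ≃ₗ[k] E} (hg : g ∈ Aut q₀ q₁)
    {t : k} (ht : (halfDiscriminant q₀ q₁ m e).eval t ≠ 0) :
    g (radicalVector m e t) = radicalVector m e t := by
  obtain ⟨c, hc⟩ := he.exists_smul_radicalVector hreg hodd (t := t)
    (v := g (radicalVector m e t)) fun w => by
      have h := he.polar_pencil_radicalVector t (g.symm w)
      rw [polar_pencil, ← (Aut.polar_apply hg _ _).1, ← (Aut.polar_apply hg _ _).2,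
        g.apply_symm_apply] at h
      rwa [polar_pencil]
  have h1 : pencil q₀ q₁ (1, t) (g (radicalVector m e t)) =
      pencil q₀ q₁ (1, t) (radicalVector m e t) := by
    rw [pencil_apply, pencil_apply, hg.1, hg.2]
  rw [← hc, QuadraticMap.map_smul, ← he.eval_halfDiscriminant, smul_eq_mul] at h1
  have h2 : c * c = 1 := mul_right_cancel₀ ht (by rw [h1, one_mul])
  have h3 : (c - 1) * (c - 1) = 0 := by
    have h4 : (2 : k) = 0 := CharTwo.two_eq_zero
    linear_combination h2 + (1 - c) * h4
  rw [← hc, sub_eq_zero.1 (mul_self_eq_zero.1 h3), one_smul]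

/-- The vectors `g (e i) - e i` are the coefficients of the polynomial `g r(t) - r(t)`, which
vanishes off the roots of the half-discriminant. Multiplying by the half-discriminant, after
applying a functional, gives a polynomial zero everywhere. -/
theorem apply_chain (he : IsKroneckerChain q₀ q₁ m e)
    (hreg : IsRegular q₀ q₁) (hodd : Odd (finrank k E)) {g : E ≃ₗ[k] E} (hg : g ∈ Aut q₀ q₁)
    (i : Fin (m + 1)) : g (e i) = e i := by
  rw [← sub_eq_zero]
  refine (Module.forall_dual_apply_eq_zero_iff k _).1 fun l => ?_
  let P : k[X] := ∑ i : Fin (m + 1), C (l (g (e i) - e i)) * X ^ (i : ℕ)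
  have hP : P = 0 := by
    refine (mul_eq_zero.1 (?_ : halfDiscriminant q₀ q₁ m e * P = 0)).resolve_left
      (he.halfDiscriminant_ne_zero hreg)
    refine Polynomial.funext fun t => ?_
    rw [eval_zero, eval_mul, mul_eq_zero]
    by_cases ht : (halfDiscriminant q₀ q₁ m e).eval t = 0
    · exact Or.inl ht
    · right
      have h := sub_eq_zero.2 (he.apply_radicalVector hreg hodd hg ht)
      have h2 : l (g (radicalVector m e t) - radicalVector m e t) = 0 := by rw [h, map_zero]
      rw [← h2]
      simp only [P, eval_finsetSum, eval_mul, eval_sub, eval_C, eval_pow, eval_X, radicalVector,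
        map_sum, map_smul, map_sub, smul_eq_mul, ← Finset.sum_sub_distrib]
      exact Finset.sum_congr rfl fun i _ => by ring
  have h := congrArg (fun p => coeff p (i : ℕ)) hP
  simp only [P, finsetSum_coeff, coeff_C_mul, coeff_X_pow, coeff_zero, mul_ite, mul_one,
    mul_zero] at h
  rw [Finset.sum_eq_single i (fun j _ hj => if_neg fun h => hj (Fin.ext h.symm)) (by simp),
    if_pos rfl] at h
  exact h

/-- Since `g` fixes each `e i` and preserves `b₁`, the vector `g v - v` is orthogonal to the chain,
which puts it in the span. -/
theorem apply_sub_mem (he : IsKroneckerChain q₀ q₁ m e)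
    (hreg : IsRegular q₀ q₁) (hodd : Odd (finrank k E)) {g : E ≃ₗ[k] E} (hg : g ∈ Aut q₀ q₁)
    (v : E) : g v - v ∈ Submodule.span k (Set.range fun i : Fin (m + 1) => e i) := by
  refine he.mem_span _ fun i hi => ?_
  have h := (Aut.polar_apply hg (e i) v).2
  rw [he.apply_chain hreg hodd hg ⟨i, by omega⟩] at h
  rw [polar_sub_right, h, sub_self]

end IsKroneckerChain

end QuadricPair

/-! ### Automorphisms as Hankel matrices -/

namespace QuadricPair

open Module QuadraticMap Polynomial

/-- Using both symmetries in turn, `h j (i + 1) = h i (j + 1) = h (j + 1) i`, so entries are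
constant along antidiagonals. Below, `H` is read off the first row and then the last column. -/
theorem exists_hankel {k : Type*} [Zero k] {m : ℕ} (h : Fin m → Fin (m + 1) → k)
    (h1 : ∀ i j : Fin m, h j i.castSucc = h i j.castSucc)
    (h0 : ∀ i j : Fin m, h j i.succ = h i j.succ) :
    ∃ H : ℕ → k, ∀ (j : Fin m) (i : Fin (m + 1)), h j i = H (i + j) := by
  rcases m with _ | m
  · exact ⟨fun _ => 0, fun j => j.elim0⟩
  let H : ℕ → k := fun n =>
    if hn : n < m + 2 then h 0 ⟨n, hn⟩
    else if hn' : n - (m + 1) < m + 1 then h ⟨n - (m + 1), hn'⟩ (Fin.last _) else 0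
  refine ⟨H, fun ⟨j, hj⟩ => ?_⟩
  induction j with
  | zero =>
    intro i
    have : (i : ℕ) + 0 < m + 2 := i.2
    simp only [H, this, dif_pos]
    rfl
  | succ j ih =>
    intro i
    have ih' := ih (by omega)
    induction i using Fin.lastCases with
    | last =>
      have e1 : ¬ (m + 1 + (j + 1) < m + 2) := by omega
      have e2 : m + 1 + (j + 1) - (m + 1) = j + 1 := by omega
      simp only [H, Fin.val_last, e1, dif_neg, not_false_eq_true, e2, hj, dif_pos]
    | cast i =>
      have := ih' i.succ
      rw [h0] at this
      have e1 : (⟨j, by omega⟩ : Fin (m + 1)).succ = (⟨j + 1, hj⟩ : Fin (m + 1)).castSucc := rfl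
      rw [e1, ← h1] at this
      rw [this]
      congr 1
      simp only [Fin.val_succ, Fin.val_castSucc]
      ring

namespace IsKroneckerChain

variable {k E : Type*} [Field k] [AddCommGroup E] [Module k E] {q₀ q₁ : QuadraticForm k E}
  {m : ℕ} {e : ℕ → E}

theorem polar_one_sum_dual (he : IsKroneckerChain q₀ q₁ m e) {f : Fin m → E}
    (hf : ∀ i j : Fin m, polar q₁ (e i) (f j) = if i = j then 1 else 0) (c : Fin (m + 1) → k)
    (j : Fin m) : polar q₁ (∑ i, c i • e i) (f j) = c j.castSucc := by
  have h : polar q₁ (∑ i, c i • e i) (f j) = ∑ i, c i * polar q₁ (e i) (f j) := by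
    change q₁.polarBilin _ _ = _
    simp
  rw [h, Fin.sum_univ_castSucc]
  simp [he.polar_last, hf]

theorem polar_zero_sum_dual (he : IsKroneckerChain q₀ q₁ m e) {f : Fin m → E}
    (hf : ∀ i j : Fin m, polar q₁ (e i) (f j) = if i = j then 1 else 0) (c : Fin (m + 1) → k)
    (j : Fin m) : polar q₀ (∑ i, c i • e i) (f j) = c j.succ := by
  have h : polar q₀ (∑ i, c i • e i) (f j) = ∑ i, c i * polar q₀ (e i) (f j) := by
    change q₀.polarBilin _ _ = _
    simp
  rw [h, Fin.sum_univ_succ]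
  simp [he.polar_zero, he.polar_succ, hf]

theorem polar_one_sum_sum [CharP k 2] (he : IsKroneckerChain q₀ q₁ m e) (c d : Fin (m + 1) → k) :
    polar q₁ (∑ i, c i • e i) (∑ i, d i • e i) = 0 := by
  change q₁.polarBilin _ _ = _
  simp [he.polar_one_eq_zero]

theorem polar_zero_sum_sum [CharP k 2] (he : IsKroneckerChain q₀ q₁ m e)
    (c d : Fin (m + 1) → k) : polar q₀ (∑ i, c i • e i) (∑ i, d i • e i) = 0 := by
  change q₀.polarBilin _ _ = _
  simp [he.polar_zero_eq_zero]

theorem polar_displacement [CharP k 2] {q : QuadraticForm k E} {v w x y : E}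
    (h : polar q (x + v) (y + w) = polar q x y) (h0 : polar q v w = 0) :
    polar q w x = polar q v y := by
  rw [polar_add_left, polar_add_right, polar_add_right, h0, polar_comm q x w] at h
  exact (CharTwo.add_eq_zero.1 (by linear_combination h))

variable [IsAlgClosed k] [CharP k 2] [FiniteDimensional k E]

/-- The displacement `g - 1` of an automorphism `g` is a Hankel matrix. -/
theorem exists_hankel_apply (he : IsKroneckerChain q₀ q₁ m e)
    (hreg : IsRegular q₀ q₁) (hn : finrank k E = 2 * m + 1) {f : Fin m → E}
    (hf : ∀ i j : Fin m, polar q₁ (e i) (f j) = if i = j then 1 else 0)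
    {g : E ≃ₗ[k] E} (hg : g ∈ Aut q₀ q₁) :
    ∃ H : ℕ → k, ∀ j, g (f j) = f j + ∑ i : Fin (m + 1), H (i + j) • e i := by
  have hmem : ∀ j, ∃ c : Fin (m + 1) → k, ∑ i, c i • e i = g (f j) - f j := fun j =>
    (Submodule.mem_span_range_iff_exists_fun k).1 (he.apply_sub_mem hreg ⟨m, hn⟩ hg (f j))
  choose h hh using hmem
  have hg' : ∀ j, g (f j) = f j + ∑ i, h j i • e i := fun j => by rw [hh]; abel
  obtain ⟨H, hH⟩ := exists_hankel h
    (fun i j => by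
      have h2 := (Aut.polar_apply hg (f i) (f j)).2
      rw [hg', hg'] at h2
      have h3 := polar_displacement h2 (he.polar_one_sum_sum _ _)
      rwa [he.polar_one_sum_dual hf, he.polar_one_sum_dual hf] at h3)
    (fun i j => by
      have h2 := (Aut.polar_apply hg (f i) (f j)).1
      rw [hg', hg'] at h2
      have h3 := polar_displacement h2 (he.polar_zero_sum_sum _ _)
      rwa [he.polar_zero_sum_dual hf, he.polar_zero_sum_dual hf] at h3)
  refine ⟨H, fun j => ?_⟩
  rw [hg']
  simp only [hH]

/-- Every automorphism differs from the identity by a sum of some of any `2 * m` of the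
endomorphisms attached to the singular points. -/
theorem exists_eq_id_add_sum (he : IsKroneckerChain q₀ q₁ m e)
    (hreg : IsRegular q₀ q₁) (hn : finrank k E = 2 * m + 1) {g : E ≃ₗ[k] E} (hg : g ∈ Aut q₀ q₁)
    {t : Fin (2 * m) → k} (ht : Function.Injective t)
    (hroot : ∀ l, (halfDiscriminant q₀ q₁ m e).eval (t l) = 0) :
    ∃ c : Fin (2 * m) → k, (∀ l, c l = 0 ∨ c l = 1) ∧
      (g : E →ₗ[k] E) =
        LinearMap.id + ∑ l, c l • reflectionPart q₁ (radicalVector m e (t l)) := by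
  obtain ⟨f, hf⟩ := he.exists_dual hn
  obtain ⟨H, hH⟩ := he.exists_hankel_apply hreg hn hf hg
  -- The Hankel entries have indices below `2 * m`, so they are moments of weights `c` at the `2 *
  -- m` roots.
  obtain ⟨c, hc⟩ := exists_sum_mul_pow_eq ht H
  have hs : ∀ l, q₁ (radicalVector m e (t l)) ≠ 0 := fun l => by
    have h := he.derivative_ne_zero_of_isRoot hreg (hroot l)
    rwa [he.eval_derivative_halfDiscriminant] at h
  have hq0 : ∀ l, q₀ (radicalVector m e (t l)) = t l * q₁ (radicalVector m e (t l)) := fun l => by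
    have h := hroot l
    rw [he.eval_halfDiscriminant, pencil_apply, one_mul] at h
    exact CharTwo.add_eq_zero.1 h
  have hdisp : ∀ j, g (f j) = f j + ∑ l, (c l * t l ^ (j : ℕ)) • radicalVector m e (t l) := by
    intro j
    rw [hH]
    congr 1
    simp only [radicalVector, Finset.smul_sum]
    rw [Finset.sum_comm]
    refine Finset.sum_congr rfl fun i _ => ?_
    simp only [smul_smul]
    rw [← Finset.sum_smul, ← hc _ (by omega)]
    congr 1
    exact Finset.sum_congr rfl fun l _ => by ring
  have hpol : ∀ j l, polar q₁ (f j) (radicalVector m e (t l)) = t l ^ (j : ℕ) := fun j l => by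
    rw [polar_comm, he.polar_one_radicalVector_dual hf]
  have hpol0 : ∀ j l, polar q₀ (f j) (radicalVector m e (t l)) = t l * t l ^ (j : ℕ) := fun j l => by
    rw [polar_comm, he.polar_zero_radicalVector, he.polar_one_radicalVector_dual hf]
  have key : ∀ (q : QuadraticForm k E) (_ : ∀ v, q (g v) = q v)
      (_ : ∀ l l', polar q (radicalVector m e (t l)) (radicalVector m e (t l')) = 0) (j : Fin m),
      ∑ l, ((c l * t l ^ (j : ℕ)) ^ 2 * q (radicalVector m e (t l)) +
        c l * t l ^ (j : ℕ) * polar q (f j) (radicalVector m e (t l))) = 0 := fun q hq hiso j => by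
    have h := hq (f j)
    rw [hdisp, QuadraticMap.map_add q,
      map_sum_smul_of_polar_eq_zero q (fun l => radicalVector m e (t l)) hiso] at h
    have h2 : polar q (f j) (∑ l, (c l * t l ^ (j : ℕ)) • radicalVector m e (t l)) =
        ∑ l, c l * t l ^ (j : ℕ) * polar q (f j) (radicalVector m e (t l)) := by
      change q.polarBilin _ _ = _
      simp
    rw [h2] at h
    rw [Finset.sum_add_distrib]
    linear_combination h
  -- Invariance of `q₁` at `f j` gives the moment of order `2 * j`. Invariance of `q₀`, with `q₀
  -- (r(t)) = t q₁ (r(t))` at roots, gives order `2 * j + 1`. All `2 * m` moments vanish.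
  have hD : (fun l => c l ^ 2 * q₁ (radicalVector m e (t l)) + c l) = 0 := by
    refine eq_zero_of_sum_mul_pow ht _ fun n hn2 => ?_
    obtain ⟨j, rfl | rfl⟩ := Nat.even_or_odd' n
    · rw [← key q₁ hg.2 (fun l l' => he.polar_one_sum_sum _ _) ⟨j, by omega⟩]
      refine Finset.sum_congr rfl fun l _ => ?_
      rw [hpol]
      ring
    · rw [← key q₀ hg.1 (fun l l' => he.polar_zero_sum_sum _ _) ⟨j, by omega⟩]
      refine Finset.sum_congr rfl fun l _ => ?_
      rw [hpol0, hq0]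
      ring
  refine ⟨fun l => c l * q₁ (radicalVector m e (t l)), fun l => ?_, ?_⟩
  · have h := congrFun hD l
    simp only [Pi.zero_apply] at h
    have h2 : c l * (c l * q₁ (radicalVector m e (t l)) + 1) = 0 := by linear_combination h
    rcases mul_eq_zero.1 h2 with h3 | h3
    · exact Or.inl (by beta_reduce; rw [h3, zero_mul])
    · exact Or.inr (CharTwo.add_eq_zero.1 h3)
  · refine he.ext_of_dual hf (fun i => ?_) fun j => ?_
    · simp [he.apply_chain hreg ⟨m, hn⟩ hg i, he.reflectionPart_chain]
    · simp only [LinearEquiv.coe_coe, LinearMap.add_apply, LinearMap.id_apply,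
        LinearMap.sum_apply, LinearMap.smul_apply, hdisp, he.reflectionPart_dual hf, smul_smul]
      congr 1
      refine Finset.sum_congr rfl fun l _ => ?_
      have := hs l
      congr 1
      field_simp

end IsKroneckerChain

end QuadricPair

/-! ### Reflections in singular points -/

namespace QuadricPair

open Module QuadraticMap

section Reflection

variable {k E : Type*} [Field k] [AddCommGroup E] [Module k E] {q₀ q₁ : QuadraticForm k E}

/-- At a singular vector of a member of the pencil, the values of all members and their
differentials are proportional. -/
theorem IsSingularVector.polar_mul_eq {x : k × k} (hx : x ≠ 0) {z : E}
    (hz : IsSingularVector (pencil q₀ q₁ x) z) (v : E) :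
    polar q₀ z v * q₁ z = polar q₁ z v * q₀ z := by
  have h1 := hz.2.1
  have h2 := hz.2.2 v
  rw [pencil_apply] at h1
  rw [polar_pencil] at h2
  by_cases hx1 : x.1 = 0
  · have hx2 : x.2 ≠ 0 := fun h => hx (Prod.ext hx1 h)
    exact mul_left_cancel₀ hx2 (by linear_combination polar q₀ z v * h1 - h2 * q₀ z)
  · exact mul_left_cancel₀ hx1 (by linear_combination h2 * q₁ z - polar q₁ z v * h1)

theorem IsSingularVector.polar_div_eq {x : k × k} (hx : x ≠ 0) {z : E}
    (hz : IsSingularVector (pencil q₀ q₁ x) z) {u u' : k × k} (hu : pencil q₀ q₁ u z ≠ 0)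
    (hu' : pencil q₀ q₁ u' z ≠ 0) (v : E) :
    polar (pencil q₀ q₁ u) z v / pencil q₀ q₁ u z =
      polar (pencil q₀ q₁ u') z v / pencil q₀ q₁ u' z := by
  rw [div_eq_div_iff hu hu']
  simp only [polar_pencil, pencil_apply]
  linear_combination (u.1 * u'.2 - u.2 * u'.1) * hz.polar_mul_eq hx v

/-- The reflection `v ↦ v + (b(z, v) / q(z)) z` of a quadratic form in characteristic two. -/
noncomputable def reflection [CharP k 2] (q : QuadraticForm k E) (z : E) : E ≃ₗ[k] E :=
  LinearEquiv.ofInvolutive (LinearMap.id + reflectionPart q z) fun v => by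
    have h : polar q z z = 0 := polar_self_eq_zero q z
    simp only [LinearMap.add_apply, LinearMap.id_apply, reflectionPart_apply, polar_add_right,
      polar_smul_right, h, smul_zero, add_zero, add_assoc]
    rw [← add_smul, CharTwo.add_self_eq_zero, zero_smul, add_zero]

theorem reflection_apply [CharP k 2] (q : QuadraticForm k E) (z v : E) :
    reflection q z v = v + (polar q z v / q z) • z := by
  rw [← reflectionPart_apply]
  rfl

theorem reflection_mem_aut [CharP k 2] {x : k × k} (hx : x ≠ 0) {z : E}
    (hz : IsSingularVector (pencil q₀ q₁ x) z) {u : k × k} (hu : pencil q₀ q₁ u z ≠ 0) :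
    reflection (pencil q₀ q₁ u) z ∈ Aut q₀ q₁ := by
  have key := hz.polar_mul_eq hx
  have main : ∀ q : QuadraticForm k E,
      (∀ v, polar (pencil q₀ q₁ u) z v * q z = polar q z v * pencil q₀ q₁ u z) →
      ∀ v, q (reflection (pencil q₀ q₁ u) z v) = q v := fun q hq v => by
    rw [reflection_apply, QuadraticMap.map_add q, QuadraticMap.map_smul, polar_smul_right,
      polar_comm q v z, smul_eq_mul, smul_eq_mul, add_assoc]
    -- With `a` the coefficient of the reflection, `q (v + a z) = q v + a (a q(z) + b(z, v))`, and
    -- the bracket is twice `b(z, v)`. No division by `q z` occurs, so `q z = 0` is allowed.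
    have h1 : polar (pencil q₀ q₁ u) z v / pencil q₀ q₁ u z * q z = polar q z v := by
      rw [div_mul_eq_mul_div, hq, mul_div_cancel_right₀ _ hu]
    rw [mul_assoc, h1, CharTwo.add_self_eq_zero, add_zero]
  refine ⟨main q₀ fun v => ?_, main q₁ fun v => ?_⟩
  · rw [polar_pencil, pencil_apply]
    linear_combination -u.2 * key v
  · rw [polar_pencil, pencil_apply]
    linear_combination u.1 * key v

end Reflection

/-! ### Linear relations with coefficients 0 and 1 -/

section Relations

variable {k V : Type*} [Field k] [AddCommGroup V] [Module k V] {n : ℕ}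
  {φ : Fin (n + 1) → V}

/-- A zero coefficient `c j` would leave a non-trivial relation among the vectors other than `φ j`.
Hence all coefficients are 1, and signs do not matter in characteristic two. -/
theorem sum_eq_zero_of_succAbove [CharP k 2]
    (hφ : ∀ p : Fin (n + 1), LinearIndependent k (fun i => φ (p.succAbove i)))
    (c : Fin n → k) (hc : ∀ i, c i = 0 ∨ c i = 1)
    (hlast : φ (Fin.last n) = ∑ i, c i • φ i.castSucc) : ∑ i, φ i = 0 := by
  let d : Fin (n + 1) → k := Fin.lastCases (-1) c
  have hd : ∑ i, d i • φ i = 0 := by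
    rw [Fin.sum_univ_castSucc]
    simp [d, ← hlast]
  have hc1 : ∀ j, c j = 1 := fun j => (hc j).resolve_left fun hj => by
    rw [Fin.sum_univ_succAbove _ j.castSucc] at hd
    simp only [d, Fin.lastCases_castSucc, hj, zero_smul, zero_add] at hd
    obtain ⟨l, hl⟩ := Fin.exists_succAbove_eq (Fin.castSucc_lt_last j).ne'
    have h := Fintype.linearIndependent_iff.1 (hφ j.castSucc) _ hd l
    rw [hl, Fin.lastCases_last] at h
    exact neg_ne_zero.2 one_ne_zero h
  rw [Fin.sum_univ_castSucc, hlast]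
  simp only [hc1, one_smul]
  rw [← two_smul k, CharTwo.two_eq_zero, zero_smul]

theorem sum_smul_eq_zero_iff
    (hφ : LinearIndependent k (fun i : Fin n => φ i.castSucc)) (h : ∑ i, φ i = 0)
    (d : Fin (n + 1) → k) : ∑ i, d i • φ i = 0 ↔ ∀ i, d i = d (Fin.last n) := by
  constructor
  · intro hd
    have h2 : ∑ i, (d i - d (Fin.last n)) • φ i = 0 := by
      simp only [sub_smul, Finset.sum_sub_distrib, hd, ← Finset.smul_sum, h, smul_zero, sub_zero]
    rw [Fin.sum_univ_castSucc, sub_self, zero_smul, add_zero] at h2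
    have h3 := Fintype.linearIndependent_iff.1 hφ _ h2
    intro i
    induction i using Fin.lastCases with
    | last => rfl
    | cast i => exact sub_eq_zero.1 (h3 i)
  · intro hd
    simp only [hd]
    rw [← Finset.smul_sum, h, smul_zero]

theorem forall_intCast_eq_iff {k : Type*} [Field k] [CharP k 2] {n : ℕ} (c : Fin (n + 1) → ℤ) :
    (∀ i, (c i : k) = c (Fin.last n)) ↔ (∀ i, Even (c i)) ∨ ∀ i, Odd (c i) := by
  have hcast : ∀ a b : ℤ, (a : k) = b ↔ (Even a ↔ Even b) := fun a b => by
    rw [← sub_eq_zero, ← Int.cast_sub, CharP.intCast_eq_zero_iff k 2, ← Int.even_sub]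
    exact even_iff_two_dvd.symm
  simp only [hcast]
  constructor
  · intro h
    rcases Int.even_or_odd (c (Fin.last n)) with h0 | h0
    · exact Or.inl fun i => (h i).2 h0
    · refine Or.inr fun i => ?_
      rw [← Int.not_even_iff_odd] at h0 ⊢
      rwa [h i]
  · rintro (h | h) i
    · simp [h]
    · simp [h, ← Int.not_odd_iff_even]

end Relations

/-! ### The displacement homomorphism -/

section Regular

variable {k E : Type*} [Field k] [IsAlgClosed k] [CharP k 2] [AddCommGroup E] [Module k E]
  [FiniteDimensional k E] {q₀ q₁ : QuadraticForm k E}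

/-- `h v - v` lies in the span of the chain, which `g` fixes pointwise. In other words `(g - 1)(h -
1) = 0`; commutativity, exponent two and additivity of `g ↦ g - 1` all follow. -/
theorem IsRegular.apply_sub (hreg : IsRegular q₀ q₁) (hodd : Odd (finrank k E))
    {g h : E ≃ₗ[k] E} (hg : g ∈ Aut q₀ q₁) (hh : h ∈ Aut q₀ q₁) (v : E) :
    g (h v) = g v + h v - v := by
  obtain ⟨m, hn⟩ := id hodd
  obtain ⟨e, he⟩ := hreg.exists_isKroneckerChain hn
  have h1 := he.apply_sub_mem hreg hodd hh v
  have h2 := LinearMap.eqOn_span (f := (g : E →ₗ[k] E)) (g := LinearMap.id)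
    (s := Set.range fun i : Fin (m + 1) => e i)
    (by rintro _ ⟨i, rfl⟩; exact he.apply_chain hreg hodd hg i) h1
  simp only [LinearEquiv.coe_coe, map_sub, LinearMap.id_apply] at h2
  rw [sub_eq_iff_eq_add] at h2
  rw [h2]
  abel

theorem IsRegular.mul_comm (hreg : IsRegular q₀ q₁) (hodd : Odd (finrank k E))
    (g h : Aut q₀ q₁) : g * h = h * g := by
  refine Subtype.ext (LinearEquiv.ext fun v => ?_)
  change (g : E ≃ₗ[k] E) ((h : E ≃ₗ[k] E) v) = (h : E ≃ₗ[k] E) ((g : E ≃ₗ[k] E) v)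
  rw [hreg.apply_sub hodd g.2 h.2, hreg.apply_sub hodd h.2 g.2, add_comm]

theorem IsRegular.pow_two_eq_one (hreg : IsRegular q₀ q₁) (hodd : Odd (finrank k E))
    (g : Aut q₀ q₁) : g ^ 2 = 1 := by
  refine Subtype.ext (LinearEquiv.ext fun v => ?_)
  rw [pow_two]
  change (g : E ≃ₗ[k] E) ((g : E ≃ₗ[k] E) v) = v
  have h2 : ∀ w : E, w + w = 0 := fun w => by
    rw [← two_smul k, CharTwo.two_eq_zero, zero_smul]
  rw [hreg.apply_sub hodd g.2 g.2, h2, zero_sub]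
  exact neg_eq_of_add_eq_zero_left (h2 v)

/-- The homomorphism `g ↦ g - 1` from the automorphism group to the additive group of
endomorphisms. -/
def IsRegular.displacement (hreg : IsRegular q₀ q₁) (hodd : Odd (finrank k E)) :
    Aut q₀ q₁ →* Multiplicative (E →ₗ[k] E) where
  toFun g := Multiplicative.ofAdd (((g : E ≃ₗ[k] E) : E →ₗ[k] E) - LinearMap.id)
  map_one' := by
    rw [← ofAdd_zero]
    congr 1
    ext v
    simp
  map_mul' g h := by
    rw [← ofAdd_add]
    congr 1
    ext v
    have := hreg.apply_sub hodd g.2 h.2 v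
    simp only [Subgroup.coe_mul, LinearMap.sub_apply, LinearEquiv.coe_coe, LinearEquiv.mul_apply,
      LinearMap.id_apply, LinearMap.add_apply, this]
    abel

theorem IsRegular.displacement_injective (hreg : IsRegular q₀ q₁) (hodd : Odd (finrank k E)) :
    Function.Injective (hreg.displacement hodd) := fun g h hgh => by
  have h1 := sub_left_injective (Multiplicative.ofAdd.injective hgh)
  exact Subtype.ext (LinearEquiv.toLinearMap_injective h1)

theorem IsRegular.displacement_prod (hreg : IsRegular q₀ q₁) (hodd : Odd (finrank k E)) {n : ℕ}
    (a : Fin n → Aut q₀ q₁) :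
    (hreg.displacement hodd (List.ofFn a).prod).toAdd =
      ∑ i, (hreg.displacement hodd (a i)).toAdd := by
  rw [map_list_prod, List.map_ofFn, List.prod_ofFn, toAdd_prod]
  rfl

theorem IsRegular.exists_smul_radicalVector (hreg : IsRegular q₀ q₁) {m : ℕ}
    (hn : finrank k E = 2 * m + 1) {e : ℕ → E} (he : IsKroneckerChain q₀ q₁ m e) {t : k} {z : E}
    (hz : IsSingularVector (pencil q₀ q₁ (1, t)) z) :
    (halfDiscriminant q₀ q₁ m e).eval t = 0 ∧
      reflectionPart q₁ z = reflectionPart q₁ (radicalVector m e t) := by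
  refine ⟨(he.exists_isSingularVector_iff hreg ⟨m, hn⟩ t).1 ⟨z, hz⟩, ?_⟩
  obtain ⟨c, rfl⟩ := he.exists_smul_radicalVector hreg ⟨m, hn⟩ hz.2.2
  exact reflectionPart_smul q₁ (fun h => hz.1 (by rw [h, zero_smul])) _

theorem IsRegular.linearIndependent_reflectionPart (hreg : IsRegular q₀ q₁) {m : ℕ}
    (hn : finrank k E = 2 * m + 1) {t : Fin (2 * m) → k} (ht : Function.Injective t)
    {z : Fin (2 * m) → E} (hz : ∀ i, IsSingularVector (pencil q₀ q₁ (1, t i)) (z i)) :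
    LinearIndependent k (fun i => reflectionPart q₁ (z i)) := by
  obtain ⟨e, he⟩ := hreg.exists_isKroneckerChain hn
  have h := fun i => hreg.exists_smul_radicalVector hn he (hz i)
  simp only [(h _).2]
  refine he.linearIndependent_reflectionPart hn ht fun l => ?_
  rw [← he.eval_derivative_halfDiscriminant]
  exact he.derivative_ne_zero_of_isRoot hreg (h l).1

theorem IsRegular.exists_eq_id_add_sum (hreg : IsRegular q₀ q₁) {m : ℕ}
    (hn : finrank k E = 2 * m + 1) {t : Fin (2 * m) → k} (ht : Function.Injective t)
    {z : Fin (2 * m) → E} (hz : ∀ i, IsSingularVector (pencil q₀ q₁ (1, t i)) (z i))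
    {g : E ≃ₗ[k] E} (hg : g ∈ Aut q₀ q₁) :
    ∃ c : Fin (2 * m) → k, (∀ i, c i = 0 ∨ c i = 1) ∧
      (g : E →ₗ[k] E) = LinearMap.id + ∑ i, c i • reflectionPart q₁ (z i) := by
  obtain ⟨e, he⟩ := hreg.exists_isKroneckerChain hn
  have h := fun i => hreg.exists_smul_radicalVector hn he (hz i)
  simp only [(h _).2]
  exact he.exists_eq_id_add_sum hreg hn hg ht fun l => (h l).1

end Regular

/-! ### Moving a nonsingular member to infinity -/

section BaseChange

variable {k E : Type*} [Field k] [AddCommGroup E] [Module k E] {q₀ q₁ : QuadraticForm k E}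

theorem pencil_swap (s u : k × k) :
    pencil q₁ (pencil q₀ q₁ s) u = pencil q₀ q₁ (u.2 * s.1, u.1 + u.2 * s.2) := by
  ext v
  simp only [pencil_apply]
  ring

theorem aut_swap (t : k) : Aut q₁ (pencil q₀ q₁ (1, t)) = Aut q₀ q₁ := by
  ext g
  change ((∀ v, q₁ (g v) = q₁ v) ∧ ∀ v, pencil q₀ q₁ (1, t) (g v) = pencil q₀ q₁ (1, t) v) ↔
    (∀ v, q₀ (g v) = q₀ v) ∧ ∀ v, q₁ (g v) = q₁ v
  simp only [pencil_apply, one_mul]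
  constructor
  · rintro ⟨h1, h2⟩
    exact ⟨fun v => by simpa [h1] using h2 v, h1⟩
  · rintro ⟨h1, h2⟩
    exact ⟨h2, fun v => by rw [h1, h2]⟩

theorem IsRegular.swap (hreg : IsRegular q₀ q₁) (t : k) :
    IsRegular q₁ (pencil q₀ q₁ (1, t)) := by
  intro v hv h1 h2
  rw [pencil_apply, h1, mul_zero, add_zero, one_mul] at h2
  have h := LinearIndependent.pair_iff.1 (hreg v hv h2 h1)
  refine LinearIndependent.pair_iff.2 fun a b hab => ?_
  have h3 := h b (a + b * t) (by
    ext w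
    have := LinearMap.congr_fun hab w
    simp only [LinearMap.add_apply, LinearMap.smul_apply, polarBilin_apply_apply, polar_pencil,
      smul_eq_mul, LinearMap.zero_apply] at this ⊢
    linear_combination this)
  obtain ⟨rfl, h4⟩ := h3
  exact ⟨by simpa using h4, rfl⟩

theorem isSingularVector_smul {c : k} (hc : c ≠ 0) (u : k × k) (v : E) :
    IsSingularVector (pencil q₀ q₁ (c • u)) v ↔ IsSingularVector (pencil q₀ q₁ u) v := by
  have h1 : ∀ w, pencil q₀ q₁ (c • u) w = c * pencil q₀ q₁ u w := fun w => by
    simp only [pencil_apply, Prod.smul_fst, Prod.smul_snd, smul_eq_mul]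
    ring
  have h2 : ∀ v w, polar (pencil q₀ q₁ (c • u)) v w = c * polar (pencil q₀ q₁ u) v w :=
    fun v w => by
      simp only [polar, h1]
      ring
  simp [IsSingularVector, h1, h2, hc]

/-- In the affine coordinate with `(1, t)` at infinity, a member without singular vectors, every
singular member is `q₁ + s (q₀ + t q₁)` up to a scalar. -/
theorem exists_affine_coordinate {t : k} (ht : ∀ v, ¬ IsSingularVector (pencil q₀ q₁ (1, t)) v)
    {x : k × k} {z : E} (hx : x ≠ 0) (hz : IsSingularVector (pencil q₀ q₁ x) z) :
    (1, t) ∉ Submodule.span k {x} ∧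
    ∃ s c : k, c ≠ 0 ∧ x = c • (s, 1 + s * t) ∧
      IsSingularVector (pencil q₁ (pencil q₀ q₁ (1, t)) (1, s)) z := by
  have hc : x.2 - x.1 * t ≠ 0 := fun h => by
    have hx' : x = x.1 • (1, t) := Prod.ext (by simp) (by simpa using sub_eq_zero.1 h)
    have h1 : x.1 ≠ 0 := fun h0 => hx (by rw [hx', h0, zero_smul])
    rw [hx', isSingularVector_smul h1] at hz
    exact ht z hz
  refine ⟨fun h => ?_, x.1 / (x.2 - x.1 * t), x.2 - x.1 * t, hc, ?_, ?_⟩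
  · obtain ⟨a, ha⟩ := Submodule.mem_span_singleton.1 h
    have h1 : a * x.1 = 1 := congrArg Prod.fst ha
    have h2 : a * x.2 = t := congrArg Prod.snd ha
    have ha0 : a ≠ 0 := fun h => by simp [h] at h1
    exact hc (mul_left_cancel₀ ha0 (by linear_combination h2 - t * h1))
  · refine Prod.ext ?_ ?_
    · simp only [Prod.smul_fst, smul_eq_mul]
      field_simp
    · simp only [Prod.smul_snd, smul_eq_mul]
      field_simp
      ring
  · rw [pencil_swap, ← isSingularVector_smul hc]
    convert hz using 2
    refine Prod.ext ?_ ?_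
    · simp only [Prod.smul_fst, smul_eq_mul]
      field_simp
    · simp only [Prod.smul_snd, smul_eq_mul]
      field_simp
      ring

end BaseChange

end QuadricPair

/-! ### Structure of the group and the set of singular members -/

namespace QuadricPair

open Module QuadraticMap

variable {k E : Type*} [Field k] [IsAlgClosed k] [CharP k 2] [AddCommGroup E] [Module k E]
  [FiniteDimensional k E] {q₀ q₁ : QuadraticForm k E}

/-- The structure of the automorphism group, given that elements `ρ i` act as the reflections in
the singular points of the members `q₀ + t i q₁`. -/
theorem IsRegular.aut_structure (hreg : IsRegular q₀ q₁) {m : ℕ}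
    (hn : finrank k E = 2 * m + 1) {t : Fin (2 * m + 1) → k} (ht : Function.Injective t)
    {z : Fin (2 * m + 1) → E} (hz : ∀ i, IsSingularVector (pencil q₀ q₁ (1, t i)) (z i))
    (ρ : Fin (2 * m + 1) → Aut q₀ q₁)
    (hρ : ∀ i, (ρ i : E ≃ₗ[k] E) = reflection q₁ (z i)) :
    Subgroup.closure (Set.range ρ) = ⊤ ∧ (List.ofFn ρ).prod = 1 ∧
      (∀ c : Fin (2 * m + 1) → ℤ,
        (List.ofFn fun i => ρ i ^ c i).prod = 1 ↔ (∀ i, Even (c i)) ∨ (∀ i, Odd (c i))) ∧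
      Nat.card (Aut q₀ q₁) = 2 ^ (2 * m) := by
  have hodd : Odd (finrank k E) := ⟨m, hn⟩
  let D := hreg.displacement hodd
  let φ : Fin (2 * m + 1) → E →ₗ[k] E := fun i => reflectionPart q₁ (z i)
  have hD : ∀ i, (D (ρ i)).toAdd = φ i := fun i => by
    change ((ρ i : E ≃ₗ[k] E) : E →ₗ[k] E) - LinearMap.id = _
    rw [hρ]
    exact add_sub_cancel_left _ _
  have hLI : ∀ p : Fin (2 * m + 1), LinearIndependent k (fun i => φ (p.succAbove i)) := fun p =>
    hreg.linearIndependent_reflectionPart hn (t := fun i => t (p.succAbove i))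
      (ht.comp Fin.succAbove_right_injective) (fun i => hz _)
  have hLI' : LinearIndependent k (fun i : Fin (2 * m) => φ i.castSucc) := by
    simpa only [Fin.succAbove_last] using hLI (Fin.last _)
  have hex : ∀ g : Aut q₀ q₁, ∃ c : Fin (2 * m) → k, (∀ i, c i = 0 ∨ c i = 1) ∧
      (D g).toAdd = ∑ i, c i • φ i.castSucc := fun g => by
    obtain ⟨c, hc, hg⟩ := hreg.exists_eq_id_add_sum hn (t := fun i => t i.castSucc)
      (ht.comp (Fin.castSucc_injective _)) (fun i => hz i.castSucc) g.2
    refine ⟨c, hc, ?_⟩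
    change ((g : E ≃ₗ[k] E) : E →ₗ[k] E) - LinearMap.id = _
    rw [hg, add_sub_cancel_left]
  -- The last reflection is itself an automorphism, so its displacement is a 0-1 combination of the
  -- others.
  have hsum : ∑ i, φ i = 0 := by
    obtain ⟨c, hc, h⟩ := hex (ρ (Fin.last _))
    rw [hD] at h
    exact sum_eq_zero_of_succAbove hLI c hc h
  have hDinj : ∀ {g h : Aut q₀ q₁}, (D g).toAdd = (D h).toAdd → g = h := fun hgh =>
    hreg.displacement_injective hodd (Multiplicative.toAdd.injective hgh)
  have hDpow : ∀ c : Fin (2 * m) → ℕ,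
      (D (List.ofFn fun i : Fin (2 * m) => ρ i.castSucc ^ c i).prod).toAdd =
        ∑ i, (c i : k) • φ i.castSucc := fun c => by
    rw [hreg.displacement_prod hodd]
    refine Finset.sum_congr rfl fun i _ => ?_
    rw [map_pow, toAdd_pow, hD, Nat.cast_smul_eq_nsmul]
  have hsurj : ∀ g : Aut q₀ q₁, ∃ c : Fin (2 * m) → Fin 2,
      (List.ofFn fun i : Fin (2 * m) => ρ i.castSucc ^ (c i : ℕ)).prod = g := fun g => by
    obtain ⟨c, hc, h⟩ := hex g
    have hc' : ∀ i, ∃ b : Fin 2, ((b : ℕ) : k) = c i := fun i => by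
      rcases hc i with h | h
      · exact ⟨0, by simp [h]⟩
      · exact ⟨1, by simp [h]⟩
    choose b hb using hc'
    refine ⟨b, hDinj ?_⟩
    rw [hDpow, h]
    simp only [hb]
  refine ⟨?_, ?_, fun c => ?_, ?_⟩
  · rw [eq_top_iff]
    rintro g -
    obtain ⟨c, rfl⟩ := hsurj g
    refine list_prod_mem fun x hx => ?_
    obtain ⟨i, rfl⟩ := (List.mem_ofFn' _ _).1 hx
    exact pow_mem (Subgroup.subset_closure (Set.mem_range_self i.castSucc)) _
  · refine hDinj ?_
    rw [hreg.displacement_prod hodd, map_one, toAdd_one, ← hsum]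
    exact Finset.sum_congr rfl fun i _ => hD i
  · have h1 : (D (List.ofFn fun i => ρ i ^ c i).prod).toAdd = ∑ i, (c i : k) • φ i := by
      rw [hreg.displacement_prod hodd]
      refine Finset.sum_congr rfl fun i _ => ?_
      rw [map_zpow, toAdd_zpow, hD, Int.cast_smul_eq_zsmul]
    rw [← forall_intCast_eq_iff (k := k), ← sum_smul_eq_zero_iff hLI' hsum, ← h1]
    constructor
    · intro h
      rw [h, map_one, toAdd_one]
    · intro h
      exact hDinj (by rw [h, map_one, toAdd_one])
  -- Each automorphism is a unique product of the first `2 * m` reflections with exponents 0 or 1.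
  · have hbij : Function.Bijective (fun c : Fin (2 * m) → Fin 2 =>
        (List.ofFn fun i : Fin (2 * m) => ρ i.castSucc ^ (c i : ℕ)).prod) := by
      refine ⟨fun c c' h => ?_, hsurj⟩
      have h2 := congrArg (fun g => (D g).toAdd) h
      simp only [hDpow] at h2
      have h3 : ∑ i, (((c i : ℕ) : k) - ((c' i : ℕ) : k)) • φ i.castSucc = 0 := by
        simp only [sub_smul, Finset.sum_sub_distrib, h2, sub_self]
      funext i
      have h4 := sub_eq_zero.1 (Fintype.linearIndependent_iff.1 hLI' _ h3 i)
      generalize c i = a at h4 ⊢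
      generalize c' i = b at h4 ⊢
      fin_cases a <;> fin_cases b <;> simp at h4 ⊢
    rw [← Nat.card_eq_of_bijective _ hbij]
    simp

/-- The structure of the automorphism group, for arbitrary representatives of the singular members
and of their singular points. -/
theorem IsRegular.exists_reflections (hreg : IsRegular q₀ q₁) {m : ℕ}
    (hn : finrank k E = 2 * m + 1) (x : Fin (2 * m + 1) → k × k) (hx : ∀ i, x i ≠ 0)
    (z : Fin (2 * m + 1) → E)
    (hinj : Function.Injective (fun i => Projectivization.mk k (x i) (hx i)))
    (hz : ∀ i, IsSingularVector (pencil q₀ q₁ (x i)) (z i)) :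
    ∃ ρ : Fin (2 * m + 1) → Aut q₀ q₁,
      (∀ i, ∀ u : k × k, u ∉ Submodule.span k {x i} →
        pencil q₀ q₁ u (z i) ≠ 0 ∧
        ∀ v : E, (ρ i : E ≃ₗ[k] E) v =
          v + (polar (pencil q₀ q₁ u) (z i) v / pencil q₀ q₁ u (z i)) • z i) ∧
      Subgroup.closure (Set.range ρ) = ⊤ ∧ (List.ofFn ρ).prod = 1 ∧
      (∀ c : Fin (2 * m + 1) → ℤ,
        (List.ofFn fun i => ρ i ^ c i).prod = 1 ↔ (∀ i, Even (c i)) ∨ (∀ i, Odd (c i))) ∧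
      Nat.card (Aut q₀ q₁) = 2 ^ (2 * m) := by
  obtain ⟨t, ht⟩ := hreg.exists_not_isSingularVector ⟨m, hn⟩
  have haff := fun i => exists_affine_coordinate ht (hx i) (hz i)
  choose hspan s c hc hxs hzs using haff
  have hsinj : Function.Injective s := fun i j hij => hinj <| by
    refine (Projectivization.mk_eq_mk_iff' k _ _ _ _).2 ⟨c i / c j, ?_⟩
    rw [hxs i, hxs j, hij, smul_smul, div_mul_cancel₀ _ (hc j)]
  have hne := fun i => hreg.pencil_ne_zero (hx i) (hz i) (hspan i)
  refine ⟨fun i => ⟨reflection (pencil q₀ q₁ (1, t)) (z i),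
    reflection_mem_aut (hx i) (hz i) (hne i)⟩, fun i u hu => ?_, ?_⟩
  · have hu' := hreg.pencil_ne_zero (hx i) (hz i) hu
    refine ⟨hu', fun v => ?_⟩
    rw [(hz i).polar_div_eq (hx i) hu' (hne i) v]
    exact reflection_apply _ _ _
  -- The group is generalized to a variable `G` so that equality of the two automorphism groups can
  -- be substituted without transporting the `ρ i`.
  · have haut : ∀ (G : Subgroup (E ≃ₗ[k] E)) (_ : Aut q₁ (pencil q₀ q₁ (1, t)) = G)
        (ρ : Fin (2 * m + 1) → G)
        (_ : ∀ i, (ρ i : E ≃ₗ[k] E) = reflection (pencil q₀ q₁ (1, t)) (z i)),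
        Subgroup.closure (Set.range ρ) = ⊤ ∧ (List.ofFn ρ).prod = 1 ∧
        (∀ c : Fin (2 * m + 1) → ℤ,
          (List.ofFn fun i => ρ i ^ c i).prod = 1 ↔ (∀ i, Even (c i)) ∨ (∀ i, Odd (c i))) ∧
        Nat.card G = 2 ^ (2 * m) := by
      rintro _ rfl ρ hρ
      exact (hreg.swap t).aut_structure hn hsinj hzs ρ hρ
    exact haut _ (aut_swap t) _ fun i => rfl

/-- The singular members are parametrized by `2 * m + 1` distinct values of an affine
coordinate. -/
theorem IsRegular.exists_singularMembers_eq (hreg : IsRegular q₀ q₁) {m : ℕ}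
    (hn : finrank k E = 2 * m + 1) :
    ∃ (x : Fin (2 * m + 1) → k × k) (hx : ∀ i, x i ≠ 0),
      Function.Injective (fun i => Projectivization.mk k (x i) (hx i)) ∧
      singularMembers q₀ q₁ = Set.range (fun i => Projectivization.mk k (x i) (hx i)) := by
  obtain ⟨t, ht⟩ := hreg.exists_not_isSingularVector ⟨m, hn⟩
  obtain ⟨S, hScard, hS⟩ := (hreg.swap t).exists_finset_card hn ht
  let s : Fin (2 * m + 1) ≃ S := (Fintype.equivFinOfCardEq (by simpa using hScard)).symm
  have hx : ∀ a : k, ((a, 1 + a * t) : k × k) ≠ 0 := fun a h => by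
    have h1 : a = 0 := congrArg Prod.fst h
    have h2 : 1 + a * t = 0 := congrArg Prod.snd h
    simp [h1] at h2
  refine ⟨fun i => ((s i : k), 1 + (s i : k) * t), fun i => hx _, fun i j hij => ?_, ?_⟩
  · obtain ⟨a, ha⟩ := (Projectivization.mk_eq_mk_iff' k _ _ _ _).1 hij
    have h1 : a * (s j : k) = s i := congrArg Prod.fst ha
    have h2 : a * (1 + (s j : k) * t) = 1 + (s i : k) * t := congrArg Prod.snd ha
    have ha1 : a = 1 := by linear_combination h2 - t * h1
    rw [ha1, one_mul] at h1
    exact s.injective (Subtype.ext h1.symm)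
  · ext p
    constructor
    · rintro ⟨u, hu, rfl, z, hz⟩
      obtain ⟨-, a, c, hc, hxa, hza⟩ := exists_affine_coordinate ht hu hz
      refine ⟨s.symm ⟨a, (hS a).2 ⟨z, hza⟩⟩, ?_⟩
      refine (Projectivization.mk_eq_mk_iff' k _ _ _ _).2 ⟨c⁻¹, ?_⟩
      beta_reduce
      rw [Equiv.apply_symm_apply, hxa, smul_smul, inv_mul_cancel₀ hc, one_smul]
    · rintro ⟨i, rfl⟩
      obtain ⟨z, hz⟩ := (hS (s i)).1 (s i).2
      rw [pencil_swap, mul_one] at hz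
      exact ⟨_, hx _, rfl, z, hz⟩

end QuadricPair

theorem mainTheorem8 {k E : Type*} [Field k] [IsAlgClosed k] [CharP k 2]
    [AddCommGroup E] [Module k E] (m : ℕ) (hm : 1 ≤ m)
    (hE : Module.finrank k E = 2 * m + 1)
    (q₀ q₁ : QuadraticForm k E) (hreg : QuadricPair.IsRegular q₀ q₁) :
    -- the group is elementary abelian of order `2 ^ (2 * m)`
    (∀ g h : QuadricPair.Aut q₀ q₁, g * h = h * g) ∧
    (∀ g : QuadricPair.Aut q₀ q₁, g ^ 2 = 1) ∧
    Nat.card (QuadricPair.Aut q₀ q₁) = 2 ^ (2 * m) ∧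
    -- the pencil has exactly `2 * m + 1` singular quadrics, each with exactly one singular point
    (QuadricPair.singularMembers q₀ q₁).ncard = 2 * m + 1 ∧
    (∀ u : k × k, u ≠ 0 → ∀ v w : E,
      QuadricPair.IsSingularVector (QuadricPair.pencil q₀ q₁ u) v →
      QuadricPair.IsSingularVector (QuadricPair.pencil q₀ q₁ u) w →
      w ∈ Submodule.span k {v}) ∧
    -- for every choice of representatives `x i` of these quadrics and `z i` of their singular points
    (∀ (x : Fin (2 * m + 1) → k × k) (hx : ∀ i, x i ≠ 0) (z : Fin (2 * m + 1) → E),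
      Function.Injective (fun i => Projectivization.mk k (x i) (hx i)) →
      (∀ i, QuadricPair.IsSingularVector (QuadricPair.pencil q₀ q₁ (x i)) (z i)) →
      ∃ ρ : Fin (2 * m + 1) → QuadricPair.Aut q₀ q₁,
        -- `ρ i` is the reflection in `z i`, whichever `u` outside the line of `x i` is used
        (∀ i, ∀ u : k × k, u ∉ Submodule.span k {x i} →
          QuadricPair.pencil q₀ q₁ u (z i) ≠ 0 ∧
          ∀ v : E, (ρ i : E ≃ₗ[k] E) v =
            v + (QuadraticMap.polar (QuadricPair.pencil q₀ q₁ u) (z i) v /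
              QuadricPair.pencil q₀ q₁ u (z i)) • z i) ∧
        -- the reflections generate
        Subgroup.closure (Set.range ρ) = ⊤ ∧
        -- the defining relation
        (List.ofFn ρ).prod = 1 ∧
        -- every relation follows from it, commutativity and `ρ i ^ 2 = 1`
        (∀ c : Fin (2 * m + 1) → ℤ,
          (List.ofFn fun i => ρ i ^ c i).prod = 1 ↔ (∀ i, Even (c i)) ∨ (∀ i, Odd (c i)))) := by
  have : FiniteDimensional k E := Module.finite_of_finrank_pos (by omega)
  have hodd : Odd (Module.finrank k E) := ⟨m, hE⟩
  obtain ⟨x, hx, hinj, hS⟩ := hreg.exists_singularMembers_eq hE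
  refine ⟨hreg.mul_comm hodd, hreg.pow_two_eq_one hodd, ?_, ?_, fun u hu v w hv hw => ?_,
    fun x hx z hinj hz => ?_⟩
  · have hz : ∀ i, ∃ z, QuadricPair.IsSingularVector (QuadricPair.pencil q₀ q₁ (x i)) z := by
      intro i
      have hi : Projectivization.mk k (x i) (hx i) ∈ QuadricPair.singularMembers q₀ q₁ := by
        rw [hS]
        exact ⟨i, rfl⟩
      obtain ⟨u, hu, hux, z, hz⟩ := hi
      obtain ⟨a, ha⟩ := (Projectivization.mk_eq_mk_iff' k _ _ _ _).1 hux
      -- The representative `u` found for this point may differ from `x i` by a scalar, which does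
      -- not affect singular vectors.
      have ha0 : a ≠ 0 := fun h => hu (by rw [← ha, h, zero_smul])
      exact ⟨z, (QuadricPair.isSingularVector_smul ha0 _ _).1 (by rwa [ha])⟩
    choose z hz using hz
    obtain ⟨ρ, -, -, -, -, hcard⟩ := hreg.exists_reflections hE x hx z hinj hz
    exact hcard
  · rw [hS, ← Set.image_univ, Set.ncard_image_of_injective _ hinj, Set.ncard_univ, Nat.card_fin]
  · obtain ⟨c, hc⟩ := hreg.mem_span_of_polar_eq_zero hodd hu hv.1 hv.2.2 hw.2.2
    exact Submodule.mem_span_singleton.2 ⟨c, hc⟩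
  · obtain ⟨ρ, h1, h2, h3, h4, -⟩ := hreg.exists_reflections hE x hx z hinj hz
    exact ⟨ρ, h1, h2, h3, h4⟩
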